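/- Let $T>0$, let $B\in\mathbb R^{n\times m}$, $C\in\mathbb R^{m\times n}$, $D\in\mathbb R^{m\times m}$, $f:[0,\infty)\times\mathbb R^n\to\mathbb R^n$ and $K:[0,\infty)\times\mathbb R^n\rightrightarrows\mathbb R^m$. Norms are Euclidean (operator norms for matrices), $\operatorname{rge}$ and $\ker$ are range and kernel, and $N_S(y)=\{v:\langle v,z-y\rangle\le 0\ \forall z\in S\}$ for $y\in S$, $N_S(y)=\emptyset$ for $y\notin S$, is the normal cone of a closed convex set $S$, with inverse $N_S^{-1}(v)=\{y: v\in N_S(y)\}$. Consider the system $$(\mathcal S)\qquad \dot x(t)=f(t,x(t))+B\lambda(t)\ \text{ for a.e. } t\in[0,T],\qquad y(t)=Cx(t)+D\lambda(t),\quad \lambda(t)\in -N_{K(t,x(t))}(y(t))\ \text{ for all } t\in[0,T],\qquad x(0)=x_0 .$$ A solution is an absolutely continuous $x:[0,T]\to\mathbb R^n$ for which there are mappings $\lambda,y:[0,T]\to\mathbb R^m$ satisfying $(\mathcal S)$. Let $\mathcal A=\{x_0: (N_{K(0,x_0)}^{-1}+D)^{-1}(Cx_0)\ne\emptyset\}$.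 Assume: 1. $K(t,x)=K_1(t)+h(t,x)$, where every $K_1(t)\subset\mathbb R^m$ ($t\ge0$) is non-empty, closed and convex, $h:[0,\infty)\times\mathbb R^n\to\operatorname{rge}(D+D^T)$ is single-valued, and there are $L_{h1},L_{h2},L_h\ge0$ such that for all $s,t\ge0$ and $x,y\in\mathbb R^n$ $$d_H\big(K_1(t)\cap\operatorname{rge}C,\;K_1(s)\cap\operatorname{rge}C\big)\le L_{h1}|t-s|,\qquad \|h(t,x)-h(s,y)\|\le L_{h2}|t-s|+L_h\|x-y\|,$$ where $d_H$ is the Hausdorff distance. 2. $\langle Dv,v\rangle\ge0$ for all $v$, $\operatorname{rge}D\subset\operatorname{rge}C$, and $\ker(D+D^T)\subset\ker(PB-C^T)$ for some symmetric positive definite $P$. 3. For all $t\ge0$ and $x,y\in\mathbb R^n$: if $(N^{-1}_{K(t,y)}+D)^{-1}(Cx)\neq\emptyset$, then $\operatorname{rge}(D+D^T)\cap(N^{-1}_{K(t,y)}+D)^{-1}(Cx)\ne\emptyset$. 4. For all $t\in[0,T]$ and $x\in\mathbb R^n$: $\operatorname{rge}C\cap\operatorname{rint}\big(\operatorname{rge}(N^{-1}_{K(t,x)}+D)\big)\neq\emptyset$,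 where $\operatorname{rint}$ is the relative interior. 5. There are a continuous $v_f:[0,\infty)\to\mathbb R$ and $L_f>0$ such that $\|f(t,x)-f(s,y)\|\le|v_f(t)-v_f(s)|+L_f\|x-y\|$ for all $s,t\ge0$ and $x,y\in\mathbb R^n$. Then for every $x_0\in\mathcal A$ the system $(\mathcal S)$ has a unique solution $x(\cdot;x_0)$ on $[0,T]$, and $x_0\mapsto x(\cdot;x_0)$ is Lipschitz continuous from $\mathcal A$ to $C([0,T];\mathbb R^n)$ with the supremum norm. If moreover condition 2 holds with $P=I$, then for every $c_1>0$ such that $\langle Dv,v\rangle\ge c_1\|v\|^2$ for all $v\in\operatorname{rge}(D+D^T)$, the solutions $x_1,x_2$ with initial points $x_{10},x_{20}\in\mathcal A$ satisfy $$\|x_1(t)-x_2(t)\|\le e^{\gamma T}\|x_{10}-x_{20}\|\quad\text{for all }t\in[0,T],\qquad \gamma=L_f+\frac{(L_h+\|B-C^T\|)^2}{4c_1}.$$ -/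

import Mathlib

open Set MeasureTheory Metric
open scoped InnerProductSpace Pointwise

/-- `ℝᵏ` with its Euclidean norm and inner product. -/
abbrev Euc (k : ℕ) : Type := EuclideanSpace ℝ (Fin k)

/-- The normal cone of `S` at `y`, that is, the subdifferential at `y` of the indicator function
of `S`. It is empty when `y ∉ S`. -/
def normalConeAt {m : ℕ} (S : Set (Euc m)) (y : Euc m) : Set (Euc m) :=
  {v | y ∈ S ∧ ∀ z ∈ S, ⟪v, z - y⟫_ℝ ≤ 0}

/-- The set-valued map `N_S⁻¹ + D`, where `N_S⁻¹ v = {y | v ∈ N_S y}`. -/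
def invNormalAdd {m : ℕ} (S : Set (Euc m)) (D : Euc m →L[ℝ] Euc m) (v : Euc m) : Set (Euc m) :=
  {w | ∃ y, v ∈ normalConeAt S y ∧ w = y + D v}

/-- The range `rge (N_S⁻¹ + D)`. -/
def invNormalAddRange {m : ℕ} (S : Set (Euc m)) (D : Euc m →L[ℝ] Euc m) : Set (Euc m) :=
  {w | ∃ v, w ∈ invNormalAdd S D v}

/-- The inverse set-valued map `(N_S⁻¹ + D)⁻¹`. -/
def feedback {m : ℕ} (S : Set (Euc m)) (D : Euc m →L[ℝ] Euc m) (w : Euc m) : Set (Euc m) :=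
  {v | w ∈ invNormalAdd S D v}

/-- The range of `D + Dᵀ`. -/
noncomputable def symRange {m : ℕ} (D : Euc m →L[ℝ] Euc m) : Submodule ℝ (Euc m) :=
  (D + ContinuousLinearMap.adjoint D).range

/-- The kernel of `D + Dᵀ`. -/
noncomputable def symKer {m : ℕ} (D : Euc m →L[ℝ] Euc m) : Submodule ℝ (Euc m) :=
  (D + ContinuousLinearMap.adjoint D).ker

/-- The admissible set of initial points:
those `x₀` for which `(N_{K(0,x₀)}⁻¹ + D)⁻¹ (C x₀)` is nonempty. -/
def admissibleSet {n m : ℕ} (C : Euc n →L[ℝ] Euc m) (D : Euc m →L[ℝ] Euc m)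
    (K : ℝ → Euc n → Set (Euc m)) : Set (Euc n) :=
  {x₀ | (feedback (K 0 x₀) D (C x₀)).Nonempty}

/-- `x` is a (strong) solution on `[0,T]`, with initial point `x₀`, of the Lur'e system
`x' = f(t,x) + B l` (almost everywhere), `y = C x + D l`, `l ∈ - N_{K(t,x)}(y)`:
`x` is absolutely continuous on `[0,T]` and there are mappings `l`, `y` satisfying the system. -/
structure IsLureSolution {n m : ℕ} (f : ℝ → Euc n → Euc n) (B : Euc m →L[ℝ] Euc n)
    (C : Euc n →L[ℝ] Euc m) (D : Euc m →L[ℝ] Euc m) (K : ℝ → Euc n → Set (Euc m))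
    (T : ℝ) (x₀ : Euc n) (x : ℝ → Euc n) : Prop where
  absolutelyContinuous : AbsolutelyContinuousOnInterval x 0 T
  initial : x 0 = x₀
  system : ∃ l y : ℝ → Euc m,
    (∀ᵐ t ∂(volume.restrict (Icc 0 T)), HasDerivAt x (f t (x t) + B (l t)) t) ∧
    (∀ t ∈ Icc 0 T, y t = C (x t) + D (l t)) ∧
    (∀ t ∈ Icc 0 T, -(l t) ∈ normalConeAt (K t (x t)) (y t))

/-! Uniqueness and continuous dependence come from passivity. Write `v = -λ`, let `d` mark
differences of two solutions, and let `q` be the norm of the projection of `dv` on `rge (D + Dᵀ)`.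
Since `F = P B - Cᵀ` vanishes on `ker (D + Dᵀ)`, `F dv` is controlled by `q`. On the other hand
`⟪dv, C dx⟫ = ⟪dv, dy⟫ + ⟪dv, D dv⟫`, which is at least `c q² - q ‖dh‖` because normal cones are
monotone, `D` is coercive on `rge (D + Dᵀ)`, and `h` takes values there. Hence `⟪P B dv, dx⟫ ≥ c q²
- q (‖dh‖ + ‖F‖ ‖dx‖)` (`dissipation`). Completing the square in `q` leaves a multiple of `-‖dx‖²`,
and Grönwall applies to `⟪P dx, dx⟫` (`IsLureSolution.quadratic_le`).

For existence, `D` and `B` both vanish on `(rge C)ᗮ`, so only the component of a multiplier in `rge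
C` matters and `K` may be replaced by its section with `rge C`, which moves in a Lipschitz way. The
relative interior condition turns normals of the section back into normals of `K`
(`exists_normal_of_normal_inter`). The reduced problem is discretized by an implicit Euler scheme
whose translation `h` is evaluated at the previous state. One step is then a linear variational
inequality for `D + τ C B`, which is positive on `rge C` for small `τ` (`exists_step`). Comparing
the new multiplier with one in `rge (D + Dᵀ)` at the previous state bounds velocity and multiplier
linearly in the state (`exists_step_bound`). The comparison multiplier is supplied afresh at every
step by condition 3, so errors do not compound and a discrete Grönwall argument gives bounds uniform
in `τ` (`exists_discrete`).

The discrete states converge along an ultrafilter to a Lipschitz function. At a point of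
differentiability its difference quotient is, up to small errors, `f - B u` with `u` an average of
discrete multipliers. Multipliers that solve the inclusion with frozen data up to `ε` form a convex
set because `D` is monotone, so `u` is one of them, and compactness yields an exact multiplier as `ε
→ 0` (`exists_multiplier_limit_of_hasDerivAt`). -/

/-- A quadratic form which is positive on a subspace of a finite-dimensional space is coercive
there. -/
lemma exists_coercive_of_pos {E : Type*} [NormedAddCommGroup E] [InnerProductSpace ℝ E]
    [FiniteDimensional ℝ E] (A : E →L[ℝ] E) (W : Submodule ℝ E)
    (h : ∀ v ∈ W, v ≠ 0 → 0 < ⟪A v, v⟫_ℝ) :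
    ∃ c : ℝ, 0 < c ∧ ∀ v ∈ W, c * ‖v‖ ^ 2 ≤ ⟪A v, v⟫_ℝ := by
  have hcomp : IsCompact (sphere (0 : E) 1 ∩ (W : Set E)) :=
    (isCompact_sphere _ _).inter_right W.closed_of_finiteDimensional
  rcases (sphere (0 : E) 1 ∩ (W : Set E)).eq_empty_or_nonempty with he | hne
  · refine ⟨1, one_pos, fun v hv => ?_⟩
    have hv0 : v = 0 := by
      by_contra hv0
      have : ‖v‖⁻¹ • v ∈ sphere (0 : E) 1 ∩ (W : Set E) := by
        refine ⟨?_, W.smul_mem _ hv⟩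
        simp [norm_smul, hv0]
      rw [he] at this
      exact this
    simp [hv0]
  · have hcont : ContinuousOn (fun v : E => ⟪A v, v⟫_ℝ) (sphere (0 : E) 1 ∩ (W : Set E)) := by
      fun_prop
    obtain ⟨u, hu, hmin⟩ := hcomp.exists_isMinOn hne hcont
    have hu0 : u ≠ 0 := by
      rintro rfl
      simpa using hu.1
    refine ⟨⟪A u, u⟫_ℝ, h u hu.2 hu0, fun v hv => ?_⟩
    by_cases hv0 : v = 0
    · simp [hv0]
    have hn : 0 < ‖v‖ := norm_pos_iff.2 hv0
    have hmem : ‖v‖⁻¹ • v ∈ sphere (0 : E) 1 ∩ (W : Set E) := by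
      refine ⟨?_, W.smul_mem _ hv⟩
      simp [norm_smul, hv0]
    have := hmin hmem
    simp only [mem_ofPred_eq, map_smul, real_inner_smul_left, real_inner_smul_right] at this
    calc ⟪A u, u⟫_ℝ * ‖v‖ ^ 2 ≤ (‖v‖⁻¹ * (‖v‖⁻¹ * ⟪A v, v⟫_ℝ)) * ‖v‖ ^ 2 := by gcongr
      _ = ⟪A v, v⟫_ℝ := by field_simp

/-! ### Monotone matrices: range and kernel of the symmetric part -/

section Monotone

variable {m : ℕ} {D : Euc m →L[ℝ] Euc m}

lemma inner_sym_apply (v w : Euc m) :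
    ⟪(D + ContinuousLinearMap.adjoint D) v, w⟫_ℝ = ⟪D v, w⟫_ℝ + ⟪D w, v⟫_ℝ := by
  rw [add_apply, inner_add_left, ContinuousLinearMap.adjoint_inner_left,
    real_inner_comm v (D w)]

lemma mem_symKer_iff {v : Euc m} : v ∈ symKer D ↔ ∀ w, ⟪D v, w⟫_ℝ + ⟪D w, v⟫_ℝ = 0 := by
  constructor
  · intro hv w
    rw [← inner_sym_apply]
    have : (D + ContinuousLinearMap.adjoint D) v = 0 := hv
    rw [this, inner_zero_left]
  · intro h
    have : (D + ContinuousLinearMap.adjoint D) v = 0 := by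
      rw [← inner_self_eq_zero (𝕜 := ℝ), inner_sym_apply]
      exact h _
    exact this

/-- An isotropic vector of a monotone matrix lies in the kernel of its symmetric part. -/
lemma mem_symKer_of_inner_nonpos (hD : ∀ v, 0 ≤ ⟪D v, v⟫_ℝ) {v : Euc m}
    (hv : ⟪D v, v⟫_ℝ ≤ 0) : v ∈ symKer D := by
  rw [mem_symKer_iff]
  intro w
  set b := ⟪D v, w⟫_ℝ + ⟪D w, v⟫_ℝ with hb
  have ha := hD w
  set a := ⟪D w, w⟫_ℝ
  have key : ∀ t : ℝ, 0 ≤ t * b + t ^ 2 * a := by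
    intro t
    have h1 := hD (v + t • w)
    have h2 : ⟪D (v + t • w), v + t • w⟫_ℝ = ⟪D v, v⟫_ℝ + t * b + t ^ 2 * a := by
      simp only [map_add, map_smul, inner_add_left, inner_add_right, real_inner_smul_left,
        real_inner_smul_right, hb, a]
      ring
    linarith
  -- A nonnegative `t b + t² a` has no linear term. This near-minimizer gives exactly `-(b / (a +
  -- 1))²`, and the `+ 1` covers `a = 0`.
  have h1 := key (-b / (a + 1))
  have h2 : -b / (a + 1) * b + (-b / (a + 1)) ^ 2 * a = -(b / (a + 1)) ^ 2 := by
    field_simp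
    ring
  rw [h2] at h1
  have h3 : b / (a + 1) = 0 := by nlinarith [sq_nonneg (b / (a + 1))]
  rcases div_eq_zero_iff.1 h3 with h | h
  · exact h
  · linarith

lemma mem_symKer_of_mem_orthogonal {v : Euc m} (hv : v ∈ (symRange D)ᗮ) : v ∈ symKer D := by
  rw [mem_symKer_iff]
  intro w
  have h1 : ⟪(D + ContinuousLinearMap.adjoint D) w, v⟫_ℝ = 0 :=
    (Submodule.mem_orthogonal _ _).1 hv _ ⟨w, rfl⟩
  rw [inner_sym_apply] at h1
  linarith

lemma eq_zero_of_mem_symRange_of_mem_symKer {v : Euc m} (hv : v ∈ symRange D)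
    (hk : v ∈ symKer D) : v = 0 := by
  obtain ⟨w, rfl⟩ := hv
  have h1 := mem_symKer_iff.1 hk w
  rw [← inner_self_eq_zero (𝕜 := ℝ)]
  change ⟪(D + ContinuousLinearMap.adjoint D) w, (D + ContinuousLinearMap.adjoint D) w⟫_ℝ = 0
  rw [inner_sym_apply]
  change ⟪D ((D + ContinuousLinearMap.adjoint D) w), w⟫_ℝ +
    ⟪D w, (D + ContinuousLinearMap.adjoint D) w⟫_ℝ = 0 at h1
  linarith

/-- A monotone matrix is coercive on the range of its symmetric part. -/
lemma exists_coercive_symRange (hD : ∀ v, 0 ≤ ⟪D v, v⟫_ℝ) :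
    ∃ c : ℝ, 0 < c ∧ ∀ v ∈ symRange D, c * ‖v‖ ^ 2 ≤ ⟪D v, v⟫_ℝ := by
  refine exists_coercive_of_pos D _ fun v hv hv0 => ?_
  by_contra hneg
  exact hv0 (eq_zero_of_mem_symRange_of_mem_symKer hv (mem_symKer_of_inner_nonpos hD
    (not_lt.1 hneg)))

/-- The orthogonal projection onto the range of the symmetric part. -/
noncomputable abbrev symProj (D : Euc m →L[ℝ] Euc m) (v : Euc m) : Euc m :=
  (symRange D).starProjection v

lemma symProj_mem (v : Euc m) : symProj D v ∈ symRange D :=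
  Submodule.starProjection_apply_mem _ _

lemma sub_symProj_mem_orthogonal (v : Euc m) : v - symProj D v ∈ (symRange D)ᗮ :=
  Submodule.sub_starProjection_mem_orthogonal v

lemma sub_symProj_mem (v : Euc m) : v - symProj D v ∈ symKer D :=
  mem_symKer_of_mem_orthogonal (sub_symProj_mem_orthogonal v)

/-- The discarded component lies in `ker (D + Dᵀ)`, so its two cross terms cancel and its own
quadratic term vanishes. -/
lemma inner_symProj (v : Euc m) : ⟪D (symProj D v), symProj D v⟫_ℝ = ⟪D v, v⟫_ℝ := by
  have h := mem_symKer_iff.1 (sub_symProj_mem (D := D) v)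
  have h1 := h (symProj D v)
  have h2 := h (v - symProj D v)
  set p := symProj D v
  have : v = p + (v - p) := by abel
  rw [this]
  set k := v - p
  rw [map_add, inner_add_left, inner_add_right, inner_add_right]
  linarith

lemma inner_symProj_right {w : Euc m} (hw : w ∈ symRange D) (v : Euc m) :
    ⟪v, w⟫_ℝ = ⟪symProj D v, w⟫_ℝ := by
  have h := (Submodule.mem_orthogonal' _ _).1 (sub_symProj_mem_orthogonal (D := D) v) w hw
  rw [inner_sub_left] at h
  linarith

lemma symProj_of_mem {v : Euc m} (hv : v ∈ symRange D) : symProj D v = v :=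
  Submodule.starProjection_eq_self_iff.2 hv

lemma symProj_sub (v w : Euc m) : symProj D (v - w) = symProj D v - symProj D w :=
  map_sub _ _ _

lemma coercive_symProj {c : ℝ} (hc : ∀ v ∈ symRange D, c * ‖v‖ ^ 2 ≤ ⟪D v, v⟫_ℝ) (v : Euc m) :
    c * ‖symProj D v‖ ^ 2 ≤ ⟪D v, v⟫_ℝ := by
  rw [← inner_symProj]
  exact hc _ (symProj_mem v)

variable {n : ℕ} {C : Euc n →L[ℝ] Euc m}

/-- If the range of a monotone `D` lies in that of `C`, then the orthogonal complement of the
range of `C` lies in the kernel of the symmetric part of `D`. -/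
lemma mem_symKer_of_mem_range_orthogonal (hD : ∀ v, 0 ≤ ⟪D v, v⟫_ℝ) (hDC : range D ⊆ range C)
    {v : Euc m} (hv : v ∈ (C.range)ᗮ) : v ∈ symKer D := by
  refine mem_symKer_of_inner_nonpos hD (le_of_eq ?_)
  exact (Submodule.mem_orthogonal _ _).1 hv _ (hDC ⟨v, rfl⟩)

/-- Since `v` is in `ker (D + Dᵀ)`, `⟪D v, D v⟫ = -⟪D (D v), v⟫`, and `D (D v)` lies in `rge C`,
orthogonal to `v`. -/
lemma apply_eq_zero_of_mem_range_orthogonal (hD : ∀ v, 0 ≤ ⟪D v, v⟫_ℝ)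
    (hDC : range D ⊆ range C) {v : Euc m} (hv : v ∈ (C.range)ᗮ) : D v = 0 := by
  have h := mem_symKer_iff.1 (mem_symKer_of_mem_range_orthogonal hD hDC hv) (D v)
  have h2 : ⟪D (D v), v⟫_ℝ = 0 := (Submodule.mem_orthogonal _ _).1 hv _ (hDC ⟨D v, rfl⟩)
  rw [← inner_self_eq_zero (𝕜 := ℝ)]
  linarith

lemma symRange_le_range (hD : ∀ v, 0 ≤ ⟪D v, v⟫_ℝ) (hDC : range D ⊆ range C) :
    symRange D ≤ C.range := by
  rw [← Submodule.orthogonal_orthogonal C.range]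
  rintro w ⟨u, rfl⟩
  rw [Submodule.mem_orthogonal']
  intro r hr
  have h := mem_symKer_iff.1 (mem_symKer_of_mem_range_orthogonal hD hDC hr) u
  change ⟪(D + ContinuousLinearMap.adjoint D) u, r⟫_ℝ = 0
  rw [inner_sym_apply]
  linarith

lemma adjoint_eq_zero_of_mem_range_orthogonal {v : Euc m} (hv : v ∈ (C.range)ᗮ) :
    ContinuousLinearMap.adjoint C v = 0 := by
  rw [← inner_self_eq_zero (𝕜 := ℝ), ContinuousLinearMap.adjoint_inner_left]
  exact (Submodule.mem_orthogonal' _ _).1 hv _ ⟨_, rfl⟩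

/-- The adjoint of `C` is bounded below on the range of `C`. -/
lemma exists_norm_le_adjoint (C : Euc n →L[ℝ] Euc m) :
    ∃ κ : ℝ, 0 ≤ κ ∧ ∀ v ∈ C.range, ‖v‖ ≤ κ * ‖ContinuousLinearMap.adjoint C v‖ := by
  have hq : ∀ v, ⟪(C.comp (ContinuousLinearMap.adjoint C)) v, v⟫_ℝ =
      ‖ContinuousLinearMap.adjoint C v‖ ^ 2 := by
    intro v
    rw [ContinuousLinearMap.comp_apply, ← ContinuousLinearMap.adjoint_inner_right,
      real_inner_self_eq_norm_sq]
  -- `C Cᵀ` is positive on `rge C`, because `Cᵀ C x = 0` forces `C x = 0`.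
  obtain ⟨c, hc, h⟩ := exists_coercive_of_pos (C.comp (ContinuousLinearMap.adjoint C)) C.range (by
    rintro v ⟨x, rfl⟩ hv0
    rw [hq]
    have : ContinuousLinearMap.adjoint C (C x) ≠ 0 := by
      intro h0
      apply hv0
      change C x = 0
      rw [← inner_self_eq_zero (𝕜 := ℝ), ← ContinuousLinearMap.adjoint_inner_left, h0,
        inner_zero_left]
    have := norm_pos_iff.2 this
    positivity)
  refine ⟨(Real.sqrt c)⁻¹, by positivity, fun v hv => ?_⟩
  have h1 := h v hv
  rw [hq] at h1
  have hs : 0 < Real.sqrt c := Real.sqrt_pos.2 hc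
  rw [inv_mul_eq_div, le_div_iff₀ hs]
  refine abs_le_of_sq_le_sq' ?_ (norm_nonneg _) |>.2
  rw [mul_pow, Real.sq_sqrt hc.le]
  linarith

end Monotone

/-! ### Convex analysis: normals of a section -/

lemma add_smul_mem_of_mem_intrinsicInterior {E : Type*} [NormedAddCommGroup E] [NormedSpace ℝ E]
    {G : Set E} {w : E} (hw : w ∈ intrinsicInterior ℝ G) {d : E} (hd : d ∈ vectorSpan ℝ G) :
    ∃ ε : ℝ, 0 < ε ∧ w + ε • d ∈ G := by
  obtain ⟨p, hp, rfl⟩ := mem_intrinsicInterior.1 hw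
  have hd' : d ∈ (affineSpan ℝ G).direction := by rwa [direction_affineSpan]
  let g : ℝ → affineSpan ℝ G := fun ε =>
    ⟨ε • d +ᵥ (p : E), AffineSubspace.vadd_mem_of_mem_direction (Submodule.smul_mem _ _ hd') p.2⟩
  have hg : Continuous g := by
    refine Continuous.subtype_mk ?_ _
    simp only [vadd_eq_add]
    fun_prop
  have h0 : g 0 = p := by ext; simp [g]
  have hev : ∀ᶠ ε in nhds (0 : ℝ), g ε ∈ ((↑) ⁻¹' G : Set (affineSpan ℝ G)) := by
    have : ((↑) ⁻¹' G : Set (affineSpan ℝ G)) ∈ nhds (g 0) := by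
      rw [h0]; exact mem_interior_iff_mem_nhds.1 hp
    exact hg.continuousAt this
  obtain ⟨δ, hδ, hball⟩ := Metric.eventually_nhds_iff.1 hev
  have := hball (y := δ / 2) (by rw [Real.dist_eq, sub_zero, abs_of_pos (by positivity)]; linarith)
  refine ⟨δ / 2, by positivity, ?_⟩
  simp only [g, mem_preimage, vadd_eq_add] at this
  rwa [add_comm] at this

/-- Sum rule for the normal cone of the intersection of a convex set with a subspace. -/
lemma exists_normal_of_normal_inter {m : ℕ} {K G : Set (Euc m)} (hK : Convex ℝ K)
    (R : Submodule ℝ (Euc m)) (hKG : K ⊆ G) (hGK : ∀ g ∈ G, ∃ z ∈ K, g - z ∈ R)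
    (hri : ((R : Set (Euc m)) ∩ intrinsicInterior ℝ G).Nonempty) {y v' : Euc m}
    (hyR : y ∈ R) (hv : v' ∈ normalConeAt (K ∩ R) y) :
    ∃ v ∈ normalConeAt K y, v - v' ∈ Rᗮ := by
  obtain ⟨⟨hyK, -⟩, hv⟩ := hv
  obtain ⟨w, hwR, hw⟩ := hri
  -- `s` is the cone generated by `K - y`. The normal sought is minus a functional that is
  -- nonnegative on `s` and equals `-⟪v', ·⟫` on `R`, to be produced by the M. Riesz extension
  -- theorem.
  let s : PointedCone ℝ (Euc m) :=
    { carrier := {u | ∃ c : ℝ, 0 ≤ c ∧ ∃ z ∈ K, u = c • (z - y)}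
      zero_mem' := ⟨0, le_rfl, y, hyK, by simp⟩
      smul_mem' := by
        rintro ⟨a, ha⟩ u ⟨c, hc, z, hz, rfl⟩
        exact ⟨a * c, mul_nonneg ha hc, z, hz, by rw [mul_smul]; rfl⟩
      add_mem' := by
        rintro u u' ⟨c, hc, z, hz, rfl⟩ ⟨c', hc', z', hz', rfl⟩
        rcases (add_nonneg hc hc').eq_or_lt with h0 | hpos
        · have h1 : c = 0 := by linarith
          have h2 : c' = 0 := by linarith
          exact ⟨0, le_rfl, y, hyK, by simp [h1, h2]⟩
        · refine ⟨c + c', hpos.le, (c / (c + c')) • z + (c' / (c + c')) • z',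
            hK hz hz' (by positivity) (by positivity) (by field_simp), ?_⟩
          match_scalars <;> field_simp
          ring }
  have hs : ∀ u, u ∈ s ↔ ∃ c : ℝ, 0 ≤ c ∧ ∃ z ∈ K, u = c • (z - y) := fun u => Iff.rfl
  let V := vectorSpan ℝ K
  let W := V ⊔ R
  have hsV : ∀ u ∈ s, u ∈ W := by
    rintro u ⟨c, -, z, hz, rfl⟩
    exact Submodule.mem_sup_left (V.smul_mem _ (vsub_mem_vectorSpan ℝ hz hyK))
  -- The extension theorem needs every vector to be moved into `s` by the domain, but `s` lies in
  -- `W`; adjoining `Wᗮ` repairs this without enlarging the intersection of the domain with `s`.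
  let p : Submodule ℝ (Euc m) := R ⊔ Wᗮ
  let f : Euc m →ₗ.[ℝ] ℝ := ⟨p, (-(innerₗ (Euc m) v')).domRestrict p⟩
  obtain ⟨g, hgf, hgs⟩ := riesz_extension s f (by
    rintro ⟨x, hx⟩ hxs
    change 0 ≤ -⟪v', x⟫_ℝ
    obtain ⟨r, hr, q, hq, rfl⟩ := Submodule.mem_sup.1 hx
    have hqW : q ∈ W := by
      have : q = (r + q) - r := by abel
      rw [this]
      exact W.sub_mem (hsV _ hxs) (Submodule.mem_sup_right hr)
    have hq0 : q = 0 := by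
      rw [← inner_self_eq_zero (𝕜 := ℝ)]
      exact (Submodule.mem_orthogonal _ _).1 hq q hqW
    subst hq0
    rw [add_zero]
    obtain ⟨c, hc, z, hz, hrz⟩ := hxs
    simp only [add_zero] at hrz
    rcases hc.eq_or_lt with h0 | hpos
    · simp [hrz, ← h0]
    · have hzR : z ∈ R := by
        have : z = c⁻¹ • r + y := by
          rw [hrz, smul_smul, inv_mul_cancel₀ hpos.ne', one_smul]; abel
        rw [this]
        exact R.add_mem (R.smul_mem _ hr) hyR
      have := hv z ⟨hz, hzR⟩
      rw [hrz, real_inner_smul_right]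
      nlinarith) (by
    intro e
    have he : e ∈ W ⊔ Wᗮ := by rw [Submodule.sup_orthogonal_of_hasOrthogonalProjection]; trivial
    obtain ⟨w', hw', q, hq, rfl⟩ := Submodule.mem_sup.1 he
    obtain ⟨d, hd, r, hr, rfl⟩ := Submodule.mem_sup.1 hw'
    -- The relative interior point can be pushed slightly along `d` inside `G`. As `G` equals `K`
    -- modulo `R`, the displacement `ε • d` is `z - y` modulo `R` for some `z ∈ K`.
    obtain ⟨ε, hε, hG⟩ := add_smul_mem_of_mem_intrinsicInterior hw (vectorSpan_mono ℝ hKG hd)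
    obtain ⟨z, hz, hzR⟩ := hGK _ hG
    have hmem : ε⁻¹ • (w - y - (w + ε • d - z)) - r - q ∈ p := by
      refine p.sub_mem (p.sub_mem (p.smul_mem _ (Submodule.mem_sup_left ?_))
        (Submodule.mem_sup_left hr)) (Submodule.mem_sup_right hq)
      exact R.sub_mem (R.sub_mem hwR hyR) hzR
    refine ⟨⟨_, hmem⟩, ?_⟩
    refine (hs _).2 ⟨ε⁻¹, by positivity, z, hz, ?_⟩
    simp only
    have : d = ε⁻¹ • (ε • d) := by rw [smul_smul, inv_mul_cancel₀ hε.ne', one_smul]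
    nth_rw 2 [this]
    module)
  let v : Euc m := -(InnerProductSpace.toDual ℝ (Euc m)).symm (LinearMap.toContinuousLinearMap g)
  have hvg : ∀ x, ⟪v, x⟫_ℝ = -g x := by
    intro x
    simp [v, inner_neg_left, InnerProductSpace.toDual_symm_apply]
  refine ⟨v, ⟨hyK, fun z hz => ?_⟩, ?_⟩
  · rw [hvg]
    have := hgs (z - y) ((hs _).2 ⟨1, zero_le_one, z, hz, by simp⟩)
    linarith
  · rw [Submodule.mem_orthogonal']
    intro r hr
    have := hgf ⟨r, Submodule.mem_sup_left hr⟩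
    change g r = -⟪v', r⟫_ℝ at this
    rw [inner_sub_left, hvg, this]
    ring

lemma mem_add_singleton_iff {E : Type*} [AddCommGroup E] {Q : Set E} {h y : E} :
    y ∈ Q + {h} ↔ ∃ a ∈ Q, y = a + h := by
  constructor
  · rintro ⟨a, ha, _, rfl, rfl⟩
    exact ⟨a, ha, rfl⟩
  · rintro ⟨a, ha, rfl⟩
    exact add_mem_add ha rfl

/-! ### The dissipation inequality -/

section Energy

variable {n m : ℕ} {B : Euc m →L[ℝ] Euc n} {C : Euc n →L[ℝ] Euc m} {D : Euc m →L[ℝ] Euc m}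
  {P : Euc n →L[ℝ] Euc n}

/-- Almost monotonicity of the normal cone with respect to a translation and a Hausdorff
perturbation of the set. -/
lemma inner_sub_ge_of_normal {Q₁ Q₂ : Set (Euc m)} {η : ℝ}
    (h12 : ∀ a ∈ Q₁, ∃ b ∈ Q₂, ‖a - b‖ ≤ η) (h21 : ∀ a ∈ Q₂, ∃ b ∈ Q₁, ‖a - b‖ ≤ η)
    {h₁ h₂ v₁ v₂ y₁ y₂ : Euc m} (hv₁ : v₁ ∈ normalConeAt (Q₁ + {h₁}) y₁)
    (hv₂ : v₂ ∈ normalConeAt (Q₂ + {h₂}) y₂) :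
    -(η * (‖v₁‖ + ‖v₂‖)) ≤ ⟪v₁ - v₂, y₁ - y₂ - (h₁ - h₂)⟫_ℝ := by
  obtain ⟨hy₁, hv₁⟩ := hv₁
  obtain ⟨hy₂, hv₂⟩ := hv₂
  obtain ⟨a₁, ha₁, rfl⟩ := mem_add_singleton_iff.1 hy₁
  obtain ⟨a₂, ha₂, rfl⟩ := mem_add_singleton_iff.1 hy₂
  -- A point of one set may not be tested against a normal of the other; its substitute in the right
  -- set costs at most `η` times the norm of that normal.
  obtain ⟨b₂, hb₂, e₂⟩ := h12 a₁ ha₁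
  obtain ⟨b₁, hb₁, e₁⟩ := h21 a₂ ha₂
  have k₁ := hv₁ _ (add_mem_add hb₁ rfl)
  have k₂ := hv₂ _ (add_mem_add hb₂ rfl)
  simp only [add_sub_add_right_eq_sub] at k₁ k₂
  have l₁ : ⟪v₁, a₂ - b₁⟫_ℝ ≤ ‖v₁‖ * η :=
    (real_inner_le_norm _ _).trans (by gcongr)
  have l₂ : ⟪v₂, a₁ - b₂⟫_ℝ ≤ ‖v₂‖ * η :=
    (real_inner_le_norm _ _).trans (by gcongr)
  have : ⟪v₁ - v₂, a₁ + h₁ - (a₂ + h₂) - (h₁ - h₂)⟫_ℝ =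
      -⟪v₁, b₁ - a₁⟫_ℝ - ⟪v₁, a₂ - b₁⟫_ℝ - ⟪v₂, b₂ - a₂⟫_ℝ - ⟪v₂, a₁ - b₂⟫_ℝ := by
    have : a₁ + h₁ - (a₂ + h₂) - (h₁ - h₂) = a₁ - a₂ := by abel
    rw [this]
    simp only [inner_sub_left, inner_sub_right]
    ring
  rw [this]
  linarith

lemma apply_symProj_of_ker_le {F : Euc m →L[ℝ] Euc n} (hF : symKer D ≤ F.ker) (v : Euc m) :
    F (symProj D v) = F v := by
  have : F (v - symProj D v) = 0 := hF (sub_symProj_mem v)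
  rw [map_sub, sub_eq_zero] at this
  exact this.symm

/-- The dissipation inequality. -/
lemma dissipation {c : ℝ} (hc : ∀ v ∈ symRange D, c * ‖v‖ ^ 2 ≤ ⟪D v, v⟫_ℝ)
    (hker : symKer D ≤ (P.comp B - ContinuousLinearMap.adjoint C).ker)
    {dv dh : Euc m} {dx : Euc n} (hdh : dh ∈ symRange D) {η : ℝ}
    (hmon : -η ≤ ⟪dv, C dx - D dv - dh⟫_ℝ) :
    c * ‖symProj D dv‖ ^ 2 -
        ‖symProj D dv‖ * (‖dh‖ + ‖P.comp B - ContinuousLinearMap.adjoint C‖ * ‖dx‖) - η ≤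
      ⟪P (B dv), dx⟫_ℝ := by
  set F := P.comp B - ContinuousLinearMap.adjoint C with hF
  have h1 : ⟪P (B dv), dx⟫_ℝ = ⟪F (symProj D dv), dx⟫_ℝ + ⟪dv, C dx⟫_ℝ := by
    rw [apply_symProj_of_ker_le hker, hF, sub_apply, inner_sub_left,
      ContinuousLinearMap.adjoint_inner_left]
    simp
  have h2 : -(‖F‖ * ‖symProj D dv‖ * ‖dx‖) ≤ ⟪F (symProj D dv), dx⟫_ℝ := by
    have := abs_real_inner_le_norm (F (symProj D dv)) dx
    have h3 := F.le_opNorm (symProj D dv)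
    have := neg_le_of_abs_le (this.trans (mul_le_mul_of_nonneg_right h3 (norm_nonneg dx)))
    linarith
  -- As `dh` lies in `rge (D + Dᵀ)`, it only meets the projection of `dv`, which the coercive term
  -- controls.
  have h4 : -(‖symProj D dv‖ * ‖dh‖) ≤ ⟪dv, dh⟫_ℝ := by
    rw [inner_symProj_right hdh]
    exact neg_le_of_abs_le (abs_real_inner_le_norm _ _)
  have h5 := coercive_symProj hc dv
  rw [inner_sub_right, inner_sub_right, real_inner_comm (D dv)] at hmon
  rw [h1]
  linarith

end Energy

/-! ### Absolutely continuous functions and Grönwall -/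

section AbsolutelyContinuous

/-- The Lipschitz estimate is asked only at values of `f`, so that quadratic forms, which are merely
locally Lipschitz, are covered. -/
lemma AbsolutelyContinuousOnInterval.comp_lipschitzOn {X Y : Type*} [PseudoMetricSpace X]
    [PseudoMetricSpace Y] {f : ℝ → X} {g : X → Y} {a b : ℝ} {L : ℝ}
    (hf : AbsolutelyContinuousOnInterval f a b)
    (hg : ∀ s ∈ uIcc a b, ∀ t ∈ uIcc a b, dist (g (f s)) (g (f t)) ≤ L * dist (f s) (f t)) :
    AbsolutelyContinuousOnInterval (fun t => g (f t)) a b := by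
  rw [absolutelyContinuousOnInterval_iff] at hf ⊢
  intro ε hε
  obtain ⟨δ, hδ, h⟩ := hf (ε / (|L| + 1)) (by positivity)
  refine ⟨δ, hδ, fun E hE hE' => ?_⟩
  have h1 := h E hE hE'
  calc ∑ i ∈ Finset.range E.1, dist (g (f (E.2 i).1)) (g (f (E.2 i).2))
      ≤ ∑ i ∈ Finset.range E.1, (|L| + 1) * dist (f (E.2 i).1) (f (E.2 i).2) := by
        refine Finset.sum_le_sum fun i hi => ?_
        have hm := hE.1 i hi
        refine (hg _ hm.1 _ hm.2).trans ?_
        gcongr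
        linarith [le_abs_self L]
    _ = (|L| + 1) * ∑ i ∈ Finset.range E.1, dist (f (E.2 i).1) (f (E.2 i).2) := by
        rw [Finset.mul_sum]
    _ < (|L| + 1) * (ε / (|L| + 1)) := by gcongr
    _ = ε := by field_simp

lemma AbsolutelyContinuousOnInterval.quadratic {E : Type*} [NormedAddCommGroup E]
    [InnerProductSpace ℝ E] {f : ℝ → E} {a b : ℝ} (hf : AbsolutelyContinuousOnInterval f a b)
    (P : E →L[ℝ] E) : AbsolutelyContinuousOnInterval (fun t => ⟪P (f t), f t⟫_ℝ) a b := by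
  obtain ⟨M, hM⟩ := hf.exists_bound
  refine hf.comp_lipschitzOn (g := fun x => ⟪P x, x⟫_ℝ) (L := 2 * ‖P‖ * M) fun s hs t ht => ?_
  rw [Real.dist_eq, dist_eq_norm]
  have h1 : ⟪P (f s), f s⟫_ℝ - ⟪P (f t), f t⟫_ℝ =
      ⟪P (f s - f t), f s⟫_ℝ + ⟪P (f t), f s - f t⟫_ℝ := by
    simp only [map_sub, inner_sub_left, inner_sub_right]
    ring
  rw [h1]
  refine (abs_add_le _ _).trans ?_
  have h2 : |⟪P (f s - f t), f s⟫_ℝ| ≤ ‖P‖ * ‖f s - f t‖ * M :=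
    (abs_real_inner_le_norm _ _).trans
      (mul_le_mul (P.le_opNorm _) (hM s hs) (norm_nonneg _) (by positivity))
  have h3 : |⟪P (f t), f s - f t⟫_ℝ| ≤ ‖P‖ * M * ‖f s - f t‖ := by
    refine (abs_real_inner_le_norm _ _).trans ?_
    gcongr
    exact (P.le_opNorm _).trans (by gcongr; exact hM t ht)
  linarith

/-- Grönwall's inequality for absolutely continuous functions. -/
lemma AbsolutelyContinuousOnInterval.le_exp_mul {φ : ℝ → ℝ} {T k : ℝ}
    (hφ : AbsolutelyContinuousOnInterval φ 0 T)
    (h : ∀ᵐ t ∂(volume.restrict (Icc 0 T)), ∃ d, HasDerivAt φ d t ∧ d ≤ k * φ t) {t : ℝ}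
    (ht : t ∈ Icc 0 T) : φ t ≤ Real.exp (k * t) * φ 0 := by
  have hexp : AbsolutelyContinuousOnInterval (fun s => Real.exp (-k * s)) 0 T := by
    apply ContDiffOn.absolutelyContinuousOnInterval
    fun_prop
  have hψ : AbsolutelyContinuousOnInterval (fun s => Real.exp (-k * s) * φ s) 0 t := by
    refine (hexp.mul hφ).mono ?_
    rw [uIcc_of_le ht.1, uIcc_of_le (ht.1.trans ht.2)]
    exact Icc_subset_Icc_right ht.2
  have hint := hψ.integral_deriv_eq_sub
  have hle : ∫ s in (0 : ℝ)..t, deriv (fun s => Real.exp (-k * s) * φ s) s ≤ 0 := by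
    rw [intervalIntegral.integral_of_le ht.1]
    refine integral_nonpos_of_ae ?_
    have hsub : Ioc 0 t ⊆ Icc 0 T := fun s hs => ⟨hs.1.le, hs.2.trans ht.2⟩
    filter_upwards [ae_restrict_of_ae_restrict_of_subset hsub h] with s ⟨d, hd, hdk⟩
    have h1 : HasDerivAt (fun s => Real.exp (-k * s)) (Real.exp (-k * s) * -k) s := by
      have := ((hasDerivAt_id s).const_mul (-k)).exp
      simpa using this
    have h2 := h1.mul hd
    have h3 : deriv (fun s => Real.exp (-k * s) * φ s) s =
        Real.exp (-k * s) * -k * φ s + Real.exp (-k * s) * d := h2.deriv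
    rw [h3]
    have : 0 < Real.exp (-k * s) := Real.exp_pos _
    change _ ≤ (0 : ℝ)
    nlinarith
  rw [hint] at hle
  have h4 : Real.exp (k * t) * Real.exp (-k * t) = 1 := by
    rw [← Real.exp_add]; simp
  have h5 : 0 < Real.exp (k * t) := Real.exp_pos _
  simp only [mul_zero, Real.exp_zero, one_mul] at hle
  calc φ t = Real.exp (k * t) * (Real.exp (-k * t) * φ t) := by rw [← mul_assoc, h4, one_mul]
    _ ≤ Real.exp (k * t) * φ 0 := by gcongr; linarith

end AbsolutelyContinuous

/-! ### Comparison of two solutions -/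

/-- Two solutions of the Lur'e system satisfy a Grönwall estimate in the `P`-norm. -/
lemma IsLureSolution.quadratic_le {n m : ℕ} {T : ℝ}
    {f : ℝ → Euc n → Euc n} {B : Euc m →L[ℝ] Euc n} {C : Euc n →L[ℝ] Euc m}
    {D : Euc m →L[ℝ] Euc m} {K : ℝ → Euc n → Set (Euc m)}
    {K₁ : ℝ → Set (Euc m)} {h : ℝ → Euc n → Euc m}
    (hK : ∀ t, 0 ≤ t → ∀ x, K t x = K₁ t + {h t x})
    (hh : ∀ t, 0 ≤ t → ∀ x, h t x ∈ symRange D)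
    {Lh Lf c : ℝ} (hLf : 0 ≤ Lf) (hc0 : 0 < c)
    (hhLip : ∀ t, 0 ≤ t → ∀ x y, ‖h t x - h t y‖ ≤ Lh * ‖x - y‖)
    (hf : ∀ t, 0 ≤ t → ∀ x y, ‖f t x - f t y‖ ≤ Lf * ‖x - y‖)
    (hc : ∀ v ∈ symRange D, c * ‖v‖ ^ 2 ≤ ⟪D v, v⟫_ℝ)
    {P : Euc n →L[ℝ] Euc n} (hPs : ∀ x y, ⟪P x, y⟫_ℝ = ⟪x, P y⟫_ℝ)
    {α : ℝ} (hα : 0 < α) (hPα : ∀ x, α * ‖x‖ ^ 2 ≤ ⟪P x, x⟫_ℝ)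
    (hker : symKer D ≤ (P.comp B - ContinuousLinearMap.adjoint C).ker)
    {x₁₀ x₂₀ : Euc n} {x₁ x₂ : ℝ → Euc n} (h₁ : IsLureSolution f B C D K T x₁₀ x₁)
    (h₂ : IsLureSolution f B C D K T x₂₀ x₂) {t : ℝ} (ht : t ∈ Icc 0 T) :
    ⟪P (x₁ t - x₂ t), x₁ t - x₂ t⟫_ℝ ≤
      Real.exp (2 * ((‖P‖ * Lf +
        (Lh + ‖P.comp B - ContinuousLinearMap.adjoint C‖) ^ 2 / (4 * c)) / α) * t) *
        ⟪P (x₁₀ - x₂₀), x₁₀ - x₂₀⟫_ℝ := by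
  set F := P.comp B - ContinuousLinearMap.adjoint C with hF
  obtain ⟨l₁, y₁, hd₁, hy₁, hl₁⟩ := h₁.system
  obtain ⟨l₂, y₂, hd₂, hy₂, hl₂⟩ := h₂.system
  have hac := (h₁.absolutelyContinuous.sub h₂.absolutelyContinuous).quadratic P
  have key := hac.le_exp_mul
    (k := 2 * ((‖P‖ * Lf + (Lh + ‖F‖) ^ 2 / (4 * c)) / α)) (by
    filter_upwards [hd₁, hd₂, ae_restrict_mem measurableSet_Icc] with s hs₁ hs₂ hs
    have hd := hs₁.sub hs₂
    have hq := (P.hasFDerivAt.comp_hasDerivAt s hd).inner ℝ hd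
    refine ⟨_, hq, ?_⟩
    set dx := (x₁ - x₂) s with hdx
    set g := f s (x₁ s) - f s (x₂ s) with hg
    set dv := -(l₁ s) - -(l₂ s) with hdv
    have hd' : f s (x₁ s) + B (l₁ s) - (f s (x₂ s) + B (l₂ s)) = g - B dv := by
      simp only [hg, hdv, map_sub, map_neg]; abel
    have e1 : ((⇑P ∘ (x₁ - x₂)) s) = P dx := rfl
    rw [e1, hd', hPs dx (g - B dv), real_inner_comm]
    have hgn : ‖g‖ ≤ Lf * ‖dx‖ := hf s hs.1 _ _
    -- Both solutions are taken at the same time, so the two sets differ only by a translation and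
    -- `η = 0`.
    have hmon := inner_sub_ge_of_normal (Q₁ := K₁ s) (Q₂ := K₁ s) (η := 0)
      (fun a ha => ⟨a, ha, by simp⟩) (fun a ha => ⟨a, ha, by simp⟩)
      (hK s hs.1 _ ▸ hl₁ s hs) (hK s hs.1 _ ▸ hl₂ s hs)
    have e2 : y₁ s - y₂ s = C dx - D dv := by
      rw [hy₁ s hs, hy₂ s hs, hdx, hdv, Pi.sub_apply, map_sub, map_sub, map_neg, map_neg]; abel
    rw [e2] at hmon
    have hdis := dissipation hc hker ((symRange D).sub_mem (hh s hs.1 (x₁ s)) (hh s hs.1 (x₂ s)))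
      (η := 0) (by linarith)
    have hdh : ‖h s (x₁ s) - h s (x₂ s)‖ ≤ Lh * ‖dx‖ := hhLip s hs.1 _ _
    rw [← hF] at hdis
    set q := ‖symProj D dv‖
    have hq0 : 0 ≤ q := norm_nonneg _
    have i1 : q * (‖h s (x₁ s) - h s (x₂ s)‖ + ‖F‖ * ‖dx‖) ≤ q * ((Lh + ‖F‖) * ‖dx‖) := by
      gcongr; linarith
    -- Completing the square in `q`; this is the origin of the factor `1 / (4 c)`.
    have i2 : q * ((Lh + ‖F‖) * ‖dx‖) - c * q ^ 2 ≤ (Lh + ‖F‖) ^ 2 / (4 * c) * ‖dx‖ ^ 2 := by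
      have : (Lh + ‖F‖) ^ 2 / (4 * c) * ‖dx‖ ^ 2 - (q * ((Lh + ‖F‖) * ‖dx‖) - c * q ^ 2) =
          ((Lh + ‖F‖) * ‖dx‖ - 2 * c * q) ^ 2 / (4 * c) := by
        field_simp; ring
      have h0 : 0 ≤ ((Lh + ‖F‖) * ‖dx‖ - 2 * c * q) ^ 2 / (4 * c) := by positivity
      linarith
    have i3 : ⟪P g, dx⟫_ℝ ≤ ‖P‖ * Lf * ‖dx‖ ^ 2 := by
      calc ⟪P g, dx⟫_ℝ ≤ ‖P g‖ * ‖dx‖ := real_inner_le_norm _ _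
        _ ≤ (‖P‖ * (Lf * ‖dx‖)) * ‖dx‖ := by
          gcongr; exact (P.le_opNorm _).trans (by gcongr)
        _ = _ := by ring
    have i4 : ⟪P (g - B dv), dx⟫_ℝ ≤ (‖P‖ * Lf + (Lh + ‖F‖) ^ 2 / (4 * c)) * ‖dx‖ ^ 2 := by
      rw [map_sub, inner_sub_left]
      linarith
    have i5 : (‖P‖ * Lf + (Lh + ‖F‖) ^ 2 / (4 * c)) * ‖dx‖ ^ 2 ≤
        (‖P‖ * Lf + (Lh + ‖F‖) ^ 2 / (4 * c)) / α * ⟪P dx, dx⟫_ℝ := by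
      rw [div_mul_eq_mul_div, le_div_iff₀ hα, mul_assoc]
      have := hPα dx
      gcongr
      linarith
    change ⟪P (g - B dv), dx⟫_ℝ + ⟪P (g - B dv), dx⟫_ℝ ≤
      2 * ((‖P‖ * Lf + (Lh + ‖F‖) ^ 2 / (4 * c)) / α) * ⟪P dx, dx⟫_ℝ
    linarith) ht
  simpa [h₁.initial, h₂.initial] using key

/-! ### Solvability of one implicit step -/

/-- Solvability of a linear coercive variational inequality. -/
lemma exists_variational_solution {E : Type*} [NormedAddCommGroup E] [InnerProductSpace ℝ E]
    [FiniteDimensional ℝ E] (M : E →L[ℝ] E) {c : ℝ} (hc : 0 < c)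
    (hM : ∀ v, c * ‖v‖ ^ 2 ≤ ⟪M v, v⟫_ℝ) {Q : Set E} (hQne : Q.Nonempty) (hQc : IsClosed Q)
    (hQ : Convex ℝ Q) (w : E) :
    ∃ v, w - M v ∈ Q ∧ ∀ z ∈ Q, ⟪v, z - (w - M v)⟫_ℝ ≤ 0 := by
  have : CompleteSpace E := FiniteDimensional.complete ℝ E
  have hinj : Function.Injective (M : E →ₗ[ℝ] E) := by
    refine (injective_iff_map_eq_zero _).2 fun v hv => ?_
    have hv' : M v = 0 := hv
    have := hM v
    rw [hv', inner_zero_left] at this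
    by_contra h0
    have : 0 < c * ‖v‖ ^ 2 := by have := norm_pos_iff.2 h0; positivity
    linarith
  let e := LinearEquiv.ofInjectiveEndo (M : E →ₗ[ℝ] E) hinj
  let N : E →L[ℝ] E := LinearMap.toContinuousLinearMap (e.symm : E →ₗ[ℝ] E)
  -- With `N = M⁻¹` and `y = w - M v`, the problem asks that `N (w - y)` be normal to `Q` at `y`,
  -- that is, `y` is the projection on `Q` of `y + ρ N (w - y)` for some `ρ > 0`.
  have hMN : ∀ u, M (N u) = u := fun u => e.apply_symm_apply u
  set b := ‖N‖ + 1 with hb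
  have hb0 : 0 < b := by positivity
  set a := c / (‖M‖ + 1) ^ 2 with ha
  have ha0 : 0 < a := by positivity
  have hNa : ∀ u, a * ‖u‖ ^ 2 ≤ ⟪N u, u⟫_ℝ := by
    intro u
    have h1 := hM (N u)
    rw [hMN, real_inner_comm] at h1
    refine le_trans ?_ h1
    have h2 : ‖u‖ ≤ (‖M‖ + 1) * ‖N u‖ := by
      calc ‖u‖ = ‖M (N u)‖ := by rw [hMN]
        _ ≤ ‖M‖ * ‖N u‖ := M.le_opNorm _
        _ ≤ _ := by gcongr; linarith
    rw [ha, div_mul_eq_mul_div, div_le_iff₀ (by positivity)]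
    calc c * ‖u‖ ^ 2 ≤ c * ((‖M‖ + 1) * ‖N u‖) ^ 2 := by gcongr
      _ = _ := by ring
  have hproj : ∀ u, ∃ p ∈ Q, ∀ z ∈ Q, ⟪u - p, z - p⟫_ℝ ≤ 0 := by
    intro u
    obtain ⟨p, hp, hpe⟩ := exists_norm_eq_iInf_of_complete_convex hQne hQc.isComplete hQ u
    exact ⟨p, hp, (norm_eq_iInf_iff_real_inner_le_zero hQ hp).1 hpe⟩
  choose p hpQ hp using hproj
  have hpn : ∀ u u', ‖p u - p u'‖ ≤ ‖u - u'‖ := by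
    intro u u'
    have h1 := hp u _ (hpQ u')
    have h2 := hp u' _ (hpQ u)
    have h3 : ‖p u - p u'‖ ^ 2 ≤ ⟪u - u', p u - p u'⟫_ℝ := by
      have : ⟪u - u', p u - p u'⟫_ℝ - ⟪p u - p u', p u - p u'⟫_ℝ =
          -⟪u - p u, p u' - p u⟫_ℝ - ⟪u' - p u', p u - p u'⟫_ℝ := by
        simp only [inner_sub_left, inner_sub_right]; ring
      rw [← real_inner_self_eq_norm_sq]
      linarith
    have h4 := real_inner_le_norm (u - u') (p u - p u')
    rcases (norm_nonneg (p u - p u')).eq_or_lt with h | h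
    · rw [← h]; exact norm_nonneg _
    · nlinarith
  -- This `ρ` minimizes the squared contraction bound `1 - 2 ρ a + ρ² b²`.
  set ρ := a / b ^ 2 with hρ
  have hρ0 : 0 < ρ := by positivity
  let T : E → E := fun y => p (y + ρ • N (w - y))
  have hk0 : ∀ d, ‖d - ρ • N d‖ ^ 2 ≤ (1 - a ^ 2 / b ^ 2) * ‖d‖ ^ 2 := by
    intro d
    have h1 : ‖d - ρ • N d‖ ^ 2 = ‖d‖ ^ 2 - 2 * (ρ * ⟪N d, d⟫_ℝ) + ρ ^ 2 * ‖N d‖ ^ 2 := by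
      rw [norm_sub_sq_real, real_inner_smul_right, norm_smul, Real.norm_of_nonneg hρ0.le,
        real_inner_comm]
      ring
    have h2 : ‖N d‖ ≤ b * ‖d‖ := (N.le_opNorm _).trans (by gcongr; linarith)
    have h3 : ρ ^ 2 * ‖N d‖ ^ 2 ≤ ρ ^ 2 * (b * ‖d‖) ^ 2 := by gcongr
    have h4 : ρ * (a * ‖d‖ ^ 2) ≤ ρ * ⟪N d, d⟫_ℝ := by gcongr; exact hNa d
    have h5 : (1 - a ^ 2 / b ^ 2) * ‖d‖ ^ 2 =
        ‖d‖ ^ 2 - 2 * (ρ * (a * ‖d‖ ^ 2)) + ρ ^ 2 * (b * ‖d‖) ^ 2 := by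
      rw [hρ]; field_simp; ring
    linarith
  have hT : ∀ y y', dist (T y) (T y') ≤ Real.sqrt (1 - a ^ 2 / b ^ 2) * dist y y' := by
    intro y y'
    rw [dist_eq_norm, dist_eq_norm]
    have h1 : y + ρ • N (w - y) - (y' + ρ • N (w - y')) = (y - y') - ρ • N (y - y') := by
      simp only [map_sub, smul_sub]; abel
    refine (hpn _ _).trans ?_
    rw [h1]
    have := Real.sqrt_le_sqrt (hk0 (y - y'))
    rwa [Real.sqrt_sq (norm_nonneg _), Real.sqrt_mul' _ (by positivity),
      Real.sqrt_sq (norm_nonneg _)] at this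
  have hcontr : ContractingWith (Real.toNNReal (Real.sqrt (1 - a ^ 2 / b ^ 2))) T := by
    refine ⟨?_, LipschitzWith.of_dist_le_mul fun y y' => ?_⟩
    · rw [← NNReal.coe_lt_coe, Real.coe_toNNReal _ (Real.sqrt_nonneg _), NNReal.coe_one,
        Real.sqrt_lt' one_pos]
      have : 0 < a ^ 2 / b ^ 2 := by positivity
      linarith
    · rw [Real.coe_toNNReal _ (Real.sqrt_nonneg _)]
      exact hT y y'
  set y := hcontr.fixedPoint T
  have hy : p (y + ρ • N (w - y)) = y := hcontr.fixedPoint_isFixedPt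
  refine ⟨N (w - y), ?_, fun z hz => ?_⟩
  · rw [hMN, sub_sub_cancel, ← hy]
    exact hpQ _
  · rw [hMN, sub_sub_cancel]
    have := hp (y + ρ • N (w - y)) z hz
    rw [hy, add_sub_cancel_left, real_inner_smul_left] at this
    nlinarith

/-- The structural conditions on the matrices of a Lur'e system: `D` is monotone with range in
that of `C`, the kernel of its symmetric part lies in that of `P B - Cᵀ`, where `P` is coercive
with constant `α`, and `D` is coercive with constant `c` on the range of its symmetric part. -/
structure IsPassiveTriple {n m : ℕ} (B : Euc m →L[ℝ] Euc n) (C : Euc n →L[ℝ] Euc m)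
    (D : Euc m →L[ℝ] Euc m) (P : Euc n →L[ℝ] Euc n) (α c : ℝ) : Prop where
  monotone : ∀ v, 0 ≤ ⟪D v, v⟫_ℝ
  range_subset : range D ⊆ range C
  alpha_pos : 0 < α
  coercive : ∀ x, α * ‖x‖ ^ 2 ≤ ⟪P x, x⟫_ℝ
  ker_le : symKer D ≤ (P.comp B - ContinuousLinearMap.adjoint C).ker
  c_pos : 0 < c
  coercive_sym : ∀ v ∈ symRange D, c * ‖v‖ ^ 2 ≤ ⟪D v, v⟫_ℝ

namespace IsPassiveTriple

variable {n m : ℕ} {B : Euc m →L[ℝ] Euc n} {C : Euc n →L[ℝ] Euc m} {D : Euc m →L[ℝ] Euc m}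
  {P : Euc n →L[ℝ] Euc n} {α c : ℝ}

lemma D_apply_orthogonal (H : IsPassiveTriple B C D P α c) {v : Euc m} (hv : v ∈ (C.range)ᗮ) :
    D v = 0 := apply_eq_zero_of_mem_range_orthogonal H.monotone H.range_subset hv

/-- Here `v ∈ ker (D + Dᵀ)`, so `P B v = Cᵀ v = 0`, and `P` is injective. With `D_apply_orthogonal`,
this makes multipliers relevant only modulo `(rge C)ᗮ`. -/
lemma B_apply_orthogonal (H : IsPassiveTriple B C D P α c) {v : Euc m} (hv : v ∈ (C.range)ᗮ) :
    B v = 0 := by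
  have h1 : P (B v) - ContinuousLinearMap.adjoint C v = 0 :=
    H.ker_le (mem_symKer_of_mem_range_orthogonal H.monotone H.range_subset hv)
  rw [adjoint_eq_zero_of_mem_range_orthogonal hv, sub_zero] at h1
  have h2 := H.coercive (B v)
  rw [h1, inner_zero_left] at h2
  by_contra h0
  have : 0 < α * ‖B v‖ ^ 2 := by
    have := norm_pos_iff.2 h0; have := H.alpha_pos; positivity
  linarith

/-- With `exists_norm_le_adjoint`, this bounds a multiplier in `rge C` by `B v` and its projection
on `rge (D + Dᵀ)`. -/
lemma adjoint_apply (H : IsPassiveTriple B C D P α c) (v : Euc m) :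
    ContinuousLinearMap.adjoint C v =
      P (B v) - (P.comp B - ContinuousLinearMap.adjoint C) (symProj D v) := by
  rw [apply_symProj_of_ker_le H.ker_le]
  simp

/-- For small steps the matrix of the implicit scheme is positive on the range of `C`. -/
lemma scheme_pos (H : IsPassiveTriple B C D P α c) {τ : ℝ} (hτ : 0 < τ)
    (hτe : τ * ‖P.comp B - ContinuousLinearMap.adjoint C‖ ^ 2 ≤ α * c) {v : Euc m}
    (hv : v ∈ C.range) (hv0 : v ≠ 0) : 0 < ⟪D v + τ • C (B v), v⟫_ℝ := by
  obtain ⟨κ, -, hκ⟩ := exists_norm_le_adjoint C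
  set F := P.comp B - ContinuousLinearMap.adjoint C with hF
  by_contra hneg
  rw [not_lt, inner_add_left, real_inner_smul_left, ← ContinuousLinearMap.adjoint_inner_right C,
    H.adjoint_apply, inner_sub_right, ← hF, real_inner_comm (P (B v))] at hneg
  have h1 := H.coercive (B v)
  have h2 := coercive_symProj H.coercive_sym v
  have h3 : ⟪B v, F (symProj D v)⟫_ℝ ≤ ‖B v‖ * (‖F‖ * ‖symProj D v‖) :=
    (real_inner_le_norm _ _).trans (by gcongr; exact F.le_opNorm _)
  set q := ‖symProj D v‖ with hq
  set b := ‖B v‖ with hb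
  have hq0 : 0 ≤ q := norm_nonneg _
  have hb0 : 0 ≤ b := norm_nonneg _
  have hα := H.alpha_pos
  have hc := H.c_pos
  -- Young's inequality; the step restriction `τ ‖F‖² ≤ α c` lets half of each good term absorb the
  -- cross term.
  have h4 : τ * (b * (‖F‖ * q)) ≤ τ * (α * b ^ 2) / 2 + c * q ^ 2 / 2 := by
    have h5 : b * (‖F‖ * q) ≤ α * b ^ 2 / 2 + ‖F‖ ^ 2 * q ^ 2 / (2 * α) := by
      have : α * b ^ 2 / 2 + ‖F‖ ^ 2 * q ^ 2 / (2 * α) - b * (‖F‖ * q) =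
        (α * b - ‖F‖ * q) ^ 2 / (2 * α) := by field_simp; ring
      have h0 : 0 ≤ (α * b - ‖F‖ * q) ^ 2 / (2 * α) := by positivity
      linarith
    have h6 : τ * (‖F‖ ^ 2 * q ^ 2 / (2 * α)) ≤ c * q ^ 2 / 2 := by
      rw [show τ * (‖F‖ ^ 2 * q ^ 2 / (2 * α)) = τ * ‖F‖ ^ 2 * (q ^ 2 / (2 * α)) by ring]
      calc τ * ‖F‖ ^ 2 * (q ^ 2 / (2 * α)) ≤ α * c * (q ^ 2 / (2 * α)) := by gcongr
        _ = c * q ^ 2 / 2 := by field_simp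
    calc τ * (b * (‖F‖ * q)) ≤ τ * (α * b ^ 2 / 2 + ‖F‖ ^ 2 * q ^ 2 / (2 * α)) := by gcongr
      _ ≤ _ := by linarith
  have h7 : τ * (α * b ^ 2 - b * (‖F‖ * q)) ≤
      τ * (⟪P (B v), B v⟫_ℝ - ⟪B v, F (symProj D v)⟫_ℝ) := by gcongr
  have h8 : c * q ^ 2 + τ * (α * b ^ 2) ≤ 0 := by linarith
  have hq1 : q = 0 := by
    by_contra h0
    have : 0 < q := lt_of_le_of_ne hq0 (Ne.symm h0)
    have : 0 < c * q ^ 2 + τ * (α * b ^ 2) := by positivity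
    linarith
  have hb1 : b = 0 := by
    by_contra h0
    have : 0 < b := lt_of_le_of_ne hb0 (Ne.symm h0)
    have : 0 < c * q ^ 2 + τ * (α * b ^ 2) := by positivity
    linarith
  have h9 := hκ v hv
  rw [H.adjoint_apply, norm_eq_zero.1 hb1, norm_eq_zero.1 hq1] at h9
  simp only [map_zero, sub_zero, norm_zero, mul_zero] at h9
  exact hv0 (norm_le_zero_iff.1 h9)

/-- Solvability of one step of the implicit scheme. -/
lemma exists_step (H : IsPassiveTriple B C D P α c) {τ : ℝ} (hτ : 0 < τ)
    (hτe : τ * ‖P.comp B - ContinuousLinearMap.adjoint C‖ ^ 2 ≤ α * c) {Q : Set (Euc m)}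
    (hQne : Q.Nonempty) (hQc : IsClosed Q) (hQ : Convex ℝ Q) (hQR : Q ⊆ range C) {h : Euc m}
    (hh : h ∈ symRange D) (x g : Euc n) :
    ∃ v ∈ C.range, v ∈ normalConeAt (Q + {h}) (C (x + τ • (g - B v)) - D v) := by
  set R := C.range with hR
  set M₀ := D + τ • (C.comp B) with hM₀
  have hM₀v : ∀ v, M₀ v = D v + τ • C (B v) := fun v => rfl
  -- `M₀` is positive on `R` only. The added projection makes the problem coercive everywhere and
  -- vanishes at the solution, since `w - M v ∈ Q ⊆ R` leaves no component of `v` in `Rᗮ`.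
  set M := M₀ + Rᗮ.starProjection with hM
  have hM₀R : ∀ v, M₀ v ∈ R := fun v =>
    R.add_mem (H.range_subset ⟨v, rfl⟩) (R.smul_mem _ ⟨_, rfl⟩)
  have hM₀o : ∀ v ∈ Rᗮ, M₀ v = 0 := by
    intro v hv
    rw [hM₀v, H.D_apply_orthogonal hv, H.B_apply_orthogonal hv]
    simp
  obtain ⟨k, hk, hcoer⟩ := exists_coercive_of_pos M ⊤ (by
    intro v _ hv0
    have hs : Rᗮ.starProjection v ∈ Rᗮ := Submodule.starProjection_apply_mem _ _
    have hr : R.starProjection v ∈ R := Submodule.starProjection_apply_mem _ _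
    have hv : v = R.starProjection v + Rᗮ.starProjection v := by
      rw [Submodule.starProjection_orthogonal_val]; abel
    have e1 : M v = M₀ v + Rᗮ.starProjection v := rfl
    rw [e1]
    set r := R.starProjection v
    set s := Rᗮ.starProjection v
    have e2 : M₀ v = M₀ r := by rw [hv, map_add, hM₀o s hs, add_zero]
    have e3 : ⟪M₀ r, s⟫_ℝ = 0 := (Submodule.mem_orthogonal _ _).1 hs _ (hM₀R r)
    have e4 : ⟪s, r⟫_ℝ = 0 := (Submodule.mem_orthogonal' _ _).1 hs _ hr
    have e5 : ⟪M₀ v + s, v⟫_ℝ = ⟪M₀ r, r⟫_ℝ + ‖s‖ ^ 2 := by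
      rw [e2]
      nth_rw 1 [hv]
      rw [inner_add_left, inner_add_right, inner_add_right, e3, e4, real_inner_self_eq_norm_sq]
      ring
    rw [e5]
    by_cases hr0 : r = 0
    · have hs0 : s ≠ 0 := by
        rintro h0
        apply hv0
        rw [hv, hr0, h0, add_zero]
      have := norm_pos_iff.2 hs0
      rw [hr0, map_zero, inner_zero_left]
      positivity
    · have := H.scheme_pos hτ hτe hr hr0
      rw [hM₀v]
      positivity)
  set w := C (x + τ • g) - h with hw
  have hwR : w ∈ R :=
    R.sub_mem ⟨_, rfl⟩ (symRange_le_range H.monotone H.range_subset hh)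
  obtain ⟨v, hv1, hv2⟩ := exists_variational_solution M hk (fun v => hcoer v trivial) hQne hQc hQ w
  have hs : Rᗮ.starProjection v ∈ Rᗮ := Submodule.starProjection_apply_mem _ _
  have hsR : Rᗮ.starProjection v ∈ R := by
    have : Rᗮ.starProjection v = w - M₀ v - (w - M v) := by
      have : M v = M₀ v + Rᗮ.starProjection v := rfl
      rw [this]; abel
    rw [this]
    exact R.sub_mem (R.sub_mem hwR (hM₀R v)) (hQR hv1)
  have hs0 : Rᗮ.starProjection v = 0 := by
    rw [← inner_self_eq_zero (𝕜 := ℝ)]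
    exact (Submodule.mem_orthogonal _ _).1 hs _ hsR
  have hvR : v ∈ R := by
    rw [Submodule.starProjection_orthogonal_val, sub_eq_zero] at hs0
    rw [hs0]
    exact Submodule.starProjection_apply_mem _ _
  have hMv : M v = M₀ v := by
    have : M v = M₀ v + Rᗮ.starProjection v := rfl
    rw [this, hs0, add_zero]
  rw [hMv] at hv1 hv2
  have hy : C (x + τ • (g - B v)) - D v = (w - M₀ v) + h := by
    rw [hM₀v, hw]
    simp only [map_add, map_smul, map_sub, smul_sub]
    abel
  refine ⟨v, hvR, ?_⟩
  rw [hy]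
  refine ⟨add_mem_add hv1 rfl, fun z hz => ?_⟩
  obtain ⟨a, ha, rfl⟩ := mem_add_singleton_iff.1 hz
  rw [add_sub_add_right_eq_sub]
  exact hv2 a ha

end IsPassiveTriple

/-! ### A priori bounds -/

/-- The scalar estimate behind the bound on the discrete velocity. -/
lemma exists_bound_of_energy {α c p β e κ L A : ℝ} (hα : 0 < α) (hc : 0 < c) (hp : 0 ≤ p)
    (hβ : 0 ≤ β) (he : 0 ≤ e) (hκ : 0 ≤ κ) (hL : 0 ≤ L) (hA : 0 ≤ A) :
    ∃ Λ : ℝ, 0 ≤ Λ ∧ ∀ τ μ ψ q g u ν d : ℝ, 0 < τ → τ ≤ 1 → 2 * (τ * e ^ 2) ≤ α * c → 1 ≤ μ →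
      0 ≤ ψ → 0 ≤ q → g ≤ A * μ → u ≤ A * μ → 0 ≤ d → τ * d ^ 2 ≤ μ ^ 2 →
      ν ≤ κ * (p * (g + ψ) + e * (u + q)) →
      α * (τ * ψ) ^ 2 ≤ τ * (p * (g + β * u) * (τ * ψ)) -
        τ * (c * q ^ 2 - q * (τ * d + e * (τ * ψ)) - L * τ * (ν + u)) →
      ψ + q ≤ Λ * μ := by
  -- With `s = ψ + q`, the estimates reduce to `δ s² ≤ a₁ μ s + a₂ μ²`, which bounds `s / μ`.
  set a₁ := p * (1 + β) * A + L * κ * (p + e) with ha₁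
  set a₂ := 1 / c + L * (κ * (p + e) * A + A) with ha₂
  have ha₁0 : 0 ≤ a₁ := by positivity
  have ha₂0 : 0 ≤ a₂ := by positivity
  set δ := min α c / 4 with hδ
  have hδ0 : 0 < δ := by have := lt_min hα hc; positivity
  refine ⟨(a₁ + a₂) / δ + 1, by positivity, ?_⟩
  intro τ μ ψ q g u ν d hτ hτ1 hτe hμ hψ hq hg hu hd hτd hν hen
  have hμ0 : 0 < μ := by linarith
  have h1 : α * ψ ^ 2 ≤ p * (g + β * u) * ψ - c / τ * q ^ 2 + q * d + q * (e * ψ) + L * (ν + u) := by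
    have h2 : τ ^ 2 * (α * ψ ^ 2) ≤ τ ^ 2 * (p * (g + β * u) * ψ - c / τ * q ^ 2 + q * d +
        q * (e * ψ) + L * (ν + u)) := by
      have : τ ^ 2 * (p * (g + β * u) * ψ - c / τ * q ^ 2 + q * d +
        q * (e * ψ) + L * (ν + u)) = τ * (p * (g + β * u) * (τ * ψ)) -
        τ * (c * q ^ 2 - q * (τ * d + e * (τ * ψ)) - L * τ * (ν + u)) := by
        field_simp; ring
      rw [this]; linarith
    exact le_of_mul_le_mul_left h2 (by positivity)
  -- After division by `τ²` the dissipation carries the weight `c / τ`, so the translation rate `d`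
  -- may be of order `τ^(-1/2)`.
  have h2 : q * d ≤ c / (4 * τ) * q ^ 2 + μ ^ 2 / c := by
    have e1 : c / (4 * τ) * q ^ 2 + τ * d ^ 2 / c - q * d = (c * q - 2 * τ * d) ^ 2 / (4 * τ * c) := by
      field_simp; ring
    have e2 : 0 ≤ (c * q - 2 * τ * d) ^ 2 / (4 * τ * c) := by positivity
    have e3 : τ * d ^ 2 / c ≤ μ ^ 2 / c := by gcongr
    linarith
  have h3 : q * (e * ψ) ≤ c / (4 * τ) * q ^ 2 + α * ψ ^ 2 / 2 := by
    have e1 : c / (4 * τ) * q ^ 2 + τ * e ^ 2 / c * ψ ^ 2 - q * (e * ψ) =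
        (c * q - 2 * τ * (e * ψ)) ^ 2 / (4 * τ * c) := by
      field_simp; ring
    have e2 : 0 ≤ (c * q - 2 * τ * (e * ψ)) ^ 2 / (4 * τ * c) := by positivity
    have e3 : τ * e ^ 2 / c ≤ α / 2 := by
      rw [div_le_iff₀ hc]; linarith
    have e4 : τ * e ^ 2 / c * ψ ^ 2 ≤ α / 2 * ψ ^ 2 := by gcongr
    linarith
  have h4 : c / 2 * q ^ 2 ≤ c / (2 * τ) * q ^ 2 := by
    gcongr
    linarith
  have h4' : c / τ * q ^ 2 = c / (2 * τ) * q ^ 2 + c / (4 * τ) * q ^ 2 + c / (4 * τ) * q ^ 2 := by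
    field_simp; ring
  have h5 : α / 2 * ψ ^ 2 + c / 2 * q ^ 2 ≤ p * (g + β * u) * ψ + μ ^ 2 / c + L * (ν + u) := by
    linarith
  set s := ψ + q with hs
  have hs0 : 0 ≤ s := by positivity
  have hμs : μ ≤ μ ^ 2 := le_self_pow₀ hμ two_ne_zero
  have h6 : p * (g + β * u) * ψ ≤ p * (1 + β) * A * (μ * s) := by
    calc p * (g + β * u) * ψ ≤ p * (A * μ + β * (A * μ)) * s := by
          gcongr
          linarith
      _ = _ := by ring
  have hνs : ν ≤ κ * (p + e) * (A * μ + s) := by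
    calc ν ≤ κ * (p * (g + ψ) + e * (u + q)) := hν
      _ ≤ κ * (p * (A * μ + s) + e * (A * μ + s)) := by gcongr <;> linarith
      _ = _ := by ring
  have hsμ : s ≤ μ * s := le_mul_of_one_le_left hs0 hμ
  have h7 : L * (ν + u) ≤ L * κ * (p + e) * (μ * s) + L * (κ * (p + e) * A + A) * μ ^ 2 := by
    calc L * (ν + u) ≤ L * (κ * (p + e) * (A * μ + s) + A * μ) := by gcongr
      _ ≤ L * (κ * (p + e) * (A * μ ^ 2 + μ * s) + A * μ ^ 2) := by gcongr
      _ = _ := by ring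
  have h8 : δ * s ^ 2 ≤ α / 2 * ψ ^ 2 + c / 2 * q ^ 2 := by
    have e1 : s ^ 2 ≤ 2 * ψ ^ 2 + 2 * q ^ 2 := by
      have e0 : 2 * ψ ^ 2 + 2 * q ^ 2 - s ^ 2 = (ψ - q) ^ 2 := by rw [hs]; ring
      linarith [sq_nonneg (ψ - q)]
    have e2 : δ ≤ α / 4 := by have := min_le_left α c; linarith
    have e3 : δ ≤ c / 4 := by have := min_le_right α c; linarith
    have e4 : δ * (2 * ψ ^ 2) ≤ α / 4 * (2 * ψ ^ 2) := by gcongr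
    have e5 : δ * (2 * q ^ 2) ≤ c / 4 * (2 * q ^ 2) := by gcongr
    have e6 : δ * s ^ 2 ≤ δ * (2 * ψ ^ 2 + 2 * q ^ 2) := by gcongr
    linarith
  have h9 : δ * s ^ 2 ≤ a₁ * (μ * s) + a₂ * μ ^ 2 := by
    have : a₁ * (μ * s) + a₂ * μ ^ 2 = p * (1 + β) * A * (μ * s) + L * κ * (p + e) * (μ * s) +
        μ ^ 2 / c + L * (κ * (p + e) * A + A) * μ ^ 2 := by
      rw [ha₁, ha₂]; ring
    linarith
  by_contra hcon
  rw [not_le] at hcon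
  have hb : (a₁ + a₂ + δ) * μ < δ * s := by
    have := mul_lt_mul_of_pos_left hcon hδ0
    have e1 : δ * (((a₁ + a₂) / δ + 1) * μ) = (a₁ + a₂ + δ) * μ := by field_simp
    linarith
  have hμs' : μ ≤ s := by
    have : (1 : ℝ) * μ ≤ ((a₁ + a₂) / δ + 1) * μ := by
      gcongr
      have : 0 ≤ (a₁ + a₂) / δ := by positivity
      linarith
    linarith
  have hspos : 0 < s := by linarith
  have e1 : (a₁ + a₂ + δ) * μ * s < δ * s * s := by gcongr
  have e2 : a₂ * (μ * μ) ≤ a₂ * (μ * s) := by gcongr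
  have e3 : 0 < δ * μ * s := by positivity
  linarith

namespace IsPassiveTriple

variable {n m : ℕ} {B : Euc m →L[ℝ] Euc n} {C : Euc n →L[ℝ] Euc m} {D : Euc m →L[ℝ] Euc m}
  {P : Euc n →L[ℝ] Euc n} {α c : ℝ}

/-- A priori bound on the velocity and the multiplier of one step of the implicit scheme. -/
lemma exists_step_bound (H : IsPassiveTriple B C D P α c) {L A : ℝ} (hL : 0 ≤ L) (hA : 0 ≤ A) :
    ∃ Λ : ℝ, 0 ≤ Λ ∧ ∀ (τ μ d : ℝ) (Q₁ Q₂ : Set (Euc m)) (h₁ h₂ u v : Euc m) (x g : Euc n),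
      0 < τ → τ ≤ 1 →
      2 * (τ * ‖P.comp B - ContinuousLinearMap.adjoint C‖ ^ 2) ≤ α * c → 1 ≤ μ →
      (∀ a ∈ Q₁, ∃ b ∈ Q₂, ‖a - b‖ ≤ L * τ) → (∀ a ∈ Q₂, ∃ b ∈ Q₁, ‖a - b‖ ≤ L * τ) →
      h₁ ∈ symRange D → h₂ ∈ symRange D → ‖h₂ - h₁‖ ≤ τ * d → 0 ≤ d → τ * d ^ 2 ≤ μ ^ 2 →
      u ∈ symRange D → v ∈ C.range → ‖g‖ ≤ A * μ → ‖u‖ ≤ A * μ →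
      u ∈ normalConeAt (Q₁ + {h₁}) (C x - D u) →
      v ∈ normalConeAt (Q₂ + {h₂}) (C (x + τ • (g - B v)) - D v) →
      ‖g - B v‖ ≤ Λ * μ ∧ ‖v‖ ≤ Λ * μ := by
  obtain ⟨κ, hκ0, hκ⟩ := exists_norm_le_adjoint C
  set F := P.comp B - ContinuousLinearMap.adjoint C with hF
  obtain ⟨Λ, hΛ0, hΛ⟩ := exists_bound_of_energy H.alpha_pos H.c_pos (norm_nonneg P) (norm_nonneg B)
    (norm_nonneg F) hκ0 hL hA
  -- The first summand bounds the velocity, the second the multiplier.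
  refine ⟨Λ + κ * (‖P‖ + ‖F‖) * (A + Λ), by positivity, ?_⟩
  intro τ μ d Q₁ Q₂ h₁ h₂ u v x g hτ hτ1 hτe hμ h12 h21 hh₁ hh₂ hdh hd hτd hu hv hgA huA hnu hnv
  have hmon := inner_sub_ge_of_normal h21 h12 hnv hnu
  set dx := τ • (g - B v) with hdx
  have e1 : C (x + dx) - D v - (C x - D u) = C dx - D (v - u) := by
    rw [map_add, map_sub]; abel
  rw [e1] at hmon
  have hdis := dissipation H.coercive_sym H.ker_le ((symRange D).sub_mem hh₂ hh₁) hmon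
  rw [← hF] at hdis
  set q := ‖symProj D (v - u)‖ with hq
  set ψ := ‖g - B v‖ with hψ
  have hdxn : ‖dx‖ = τ * ψ := by rw [hdx, norm_smul, Real.norm_of_nonneg hτ.le]
  have hsv : ‖symProj D v‖ ≤ ‖u‖ + q := by
    have : symProj D v = u + symProj D (v - u) := by
      rw [symProj_sub, symProj_of_mem hu]; abel
    rw [this]
    exact norm_add_le _ _
  have hBv : ‖B v‖ ≤ ‖g‖ + ψ := by
    have : B v = g - (g - B v) := by abel
    rw [this]
    exact norm_sub_le _ _
  have hν : ‖v‖ ≤ κ * (‖P‖ * (‖g‖ + ψ) + ‖F‖ * (‖u‖ + q)) := by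
    refine (hκ v hv).trans ?_
    gcongr
    rw [H.adjoint_apply]
    refine (norm_sub_le _ _).trans (add_le_add ?_ ?_)
    · exact (P.le_opNorm _).trans (by gcongr)
    · exact (F.le_opNorm _).trans (by gcongr)
  have hcoer := H.coercive dx
  -- Splitting `B v` at `B u` leaves a part bounded by known data and a part controlled by
  -- dissipation.
  have hPdx : ⟪P dx, dx⟫_ℝ = τ * ⟪P (g - B u), dx⟫_ℝ - τ * ⟪P (B (v - u)), dx⟫_ℝ := by
    have : P dx = τ • P (g - B u) - τ • P (B (v - u)) := by
      rw [hdx, map_smul, ← smul_sub, ← map_sub, map_sub B]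
      congr 2
      abel
    rw [this, inner_sub_left, real_inner_smul_left, real_inner_smul_left]
  have hPg : ⟪P (g - B u), dx⟫_ℝ ≤ ‖P‖ * (‖g‖ + ‖B‖ * ‖u‖) * (τ * ψ) := by
    rw [← hdxn]
    refine (real_inner_le_norm _ _).trans ?_
    gcongr
    refine (P.le_opNorm _).trans ?_
    gcongr
    exact (norm_sub_le _ _).trans (by gcongr; exact B.le_opNorm _)
  have hen : α * (τ * ψ) ^ 2 ≤ τ * (‖P‖ * (‖g‖ + ‖B‖ * ‖u‖) * (τ * ψ)) -
        τ * (c * q ^ 2 - q * (τ * d + ‖F‖ * (τ * ψ)) - L * τ * (‖v‖ + ‖u‖)) := by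
    have i1 : τ * ⟪P (g - B u), dx⟫_ℝ ≤ τ * (‖P‖ * (‖g‖ + ‖B‖ * ‖u‖) * (τ * ψ)) := by gcongr
    have i2 : c * q ^ 2 - q * (τ * d + ‖F‖ * (τ * ψ)) - L * τ * (‖v‖ + ‖u‖) ≤
        ⟪P (B (v - u)), dx⟫_ℝ := by
      refine le_trans ?_ hdis
      rw [hdxn]
      gcongr
    have i3 := mul_le_mul_of_nonneg_left i2 hτ.le
    rw [hdxn] at hcoer
    linarith
  have hs := hΛ τ μ ψ q ‖g‖ ‖u‖ ‖v‖ d hτ hτ1 hτe hμ (norm_nonneg _) (norm_nonneg _) hgA huA hd hτd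
    hν hen
  have hψ0 : 0 ≤ ψ := norm_nonneg _
  have hq0 : 0 ≤ q := norm_nonneg _
  have hμ0 : 0 ≤ μ := by linarith
  have hvb : ‖v‖ ≤ κ * (‖P‖ + ‖F‖) * (A + Λ) * μ := by
    calc ‖v‖ ≤ κ * (‖P‖ * (‖g‖ + ψ) + ‖F‖ * (‖u‖ + q)) := hν
      _ ≤ κ * (‖P‖ * (A * μ + Λ * μ) + ‖F‖ * (A * μ + Λ * μ)) := by gcongr <;> linarith
      _ = _ := by ring
  have n1 : 0 ≤ κ * (‖P‖ + ‖F‖) * (A + Λ) * μ := by positivity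
  have n2 : 0 ≤ Λ * μ := by positivity
  constructor <;> rw [add_mul] <;> linarith

end IsPassiveTriple

/-! ### The implicit Euler scheme -/

/-- The regularity used to solve a Lur'e system by discretization: the sets `K₁(t) ∩ rge C` and
the translation `h` vary in a Lipschitz way, and the feedback restricted to `rge C` meets
`rge (D + Dᵀ)` wherever it is nonempty. -/
structure IsSweepingData {n m : ℕ} (C : Euc n →L[ℝ] Euc m) (D : Euc m →L[ℝ] Euc m)
    (K₁ : ℝ → Set (Euc m)) (h : ℝ → Euc n → Euc m) (T L : ℝ) : Prop where
  lip_nonneg : 0 ≤ L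
  isClosed : ∀ t, 0 ≤ t → IsClosed (K₁ t ∩ range C)
  convex : ∀ t, 0 ≤ t → Convex ℝ (K₁ t ∩ range C)
  nonempty : ∀ t, 0 ≤ t → (K₁ t ∩ range C).Nonempty
  near : ∀ t s, 0 ≤ t → 0 ≤ s → ∀ a ∈ K₁ t ∩ range C, ∃ b ∈ K₁ s ∩ range C, ‖a - b‖ ≤ L * |t - s|
  trans_mem : ∀ t, 0 ≤ t → ∀ x, h t x ∈ symRange D
  trans_lip : ∀ t s, 0 ≤ t → 0 ≤ s → ∀ x y, ‖h t x - h s y‖ ≤ L * (|t - s| + ‖x - y‖)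
  meet : ∀ t ∈ Icc 0 T, ∀ x y, ∀ v ∈ C.range,
    v ∈ normalConeAt ((K₁ t ∩ range C) + {h t y}) (C x - D v) →
    ∃ u ∈ symRange D, u ∈ normalConeAt ((K₁ t ∩ range C) + {h t y}) (C x - D u)

/-- `X` and `v` are the states and the multipliers of `N` steps of length `τ` of the implicit Euler
scheme, with states, multipliers and velocities bounded by `V`. -/
structure IsEulerScheme {n m : ℕ} (f : ℝ → Euc n → Euc n) (B : Euc m →L[ℝ] Euc n)
    (C : Euc n →L[ℝ] Euc m) (D : Euc m →L[ℝ] Euc m) (K₁ : ℝ → Set (Euc m))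
    (h : ℝ → Euc n → Euc m) (τ V : ℝ) (N : ℕ) (X : ℕ → Euc n) (v : ℕ → Euc m) : Prop where
  step : ∀ i < N, X (i + 1) = X i + τ • (f (i * τ) (X i) - B (v (i + 1)))
  multiplier : ∀ i ≤ N, v i ∈ C.range ∧ ‖v i‖ ≤ V ∧ ‖X i‖ ≤ V ∧
    v i ∈ normalConeAt ((K₁ (i * τ) ∩ range C) + {h (i * τ) (X (i - 1))}) (C (X i) - D (v i))
  velocity : ∀ i < N, ‖X (i + 1) - X i‖ ≤ V * τ

namespace IsSweepingData

variable {n m : ℕ} {B : Euc m →L[ℝ] Euc n} {C : Euc n →L[ℝ] Euc m} {D : Euc m →L[ℝ] Euc m}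
  {P : Euc n →L[ℝ] Euc n} {α c : ℝ} {K₁ : ℝ → Set (Euc m)} {h : ℝ → Euc n → Euc m} {T L : ℝ}

/-- The multiplier in `rge (D + Dᵀ)` grows at most linearly. -/
lemma exists_multiplier_bound (S : IsSweepingData C D K₁ h T L) (hT : 0 ≤ T)
    (H : IsPassiveTriple B C D P α c) :
    ∃ A : ℝ, 0 ≤ A ∧ ∀ t ∈ Icc 0 T, ∀ (x y : Euc n) (u : Euc m) (μ : ℝ), 1 + ‖x‖ ≤ μ →
      1 + ‖y‖ ≤ μ → u ∈ symRange D →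
      u ∈ normalConeAt ((K₁ t ∩ range C) + {h t y}) (C x - D u) → ‖u‖ ≤ A * μ := by
  have hL := S.lip_nonneg
  have hc := H.c_pos
  obtain ⟨z₀, hz₀⟩ := S.nonempty 0 le_rfl
  refine ⟨(‖z₀‖ + L * T + ‖h 0 0‖ + L * (T + 1) + ‖C‖) / c, by positivity, ?_⟩
  intro t ht x y u μ hx hy hu hn
  -- Testing the normal inequality at a point `z` of the section near a fixed one gives `c ‖u‖² ≤
  -- ‖u‖ ‖z + h t y - C x‖` by coercivity.
  obtain ⟨z, hz, hzz⟩ := S.near 0 t le_rfl ht.1 z₀ hz₀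
  have hx0 := norm_nonneg x
  have hy0 := norm_nonneg y
  have hμ : 1 ≤ μ := by linarith
  have hz1 : ‖z‖ ≤ ‖z₀‖ + L * T := by
    have h1 : ‖z‖ ≤ ‖z₀‖ + ‖z₀ - z‖ := norm_le_norm_add_norm_sub z₀ z
    rw [zero_sub, abs_neg, abs_of_nonneg ht.1] at hzz
    have : L * t ≤ L * T := by gcongr; exact ht.2
    linarith
  have hh1 : ‖h t y‖ ≤ ‖h 0 0‖ + L * (T + μ) := by
    have h1 := S.trans_lip t 0 ht.1 le_rfl y 0
    rw [sub_zero, sub_zero, abs_of_nonneg ht.1] at h1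
    have h2 := norm_le_norm_add_norm_sub' (h t y) (h 0 0)
    have : L * (t + ‖y‖) ≤ L * (T + μ) := by
      gcongr
      · exact ht.2
      · linarith
    linarith
  have hzv := hn.2 _ (add_mem_add hz rfl)
  have h3 := H.coercive_sym u hu
  have h4 : ⟪u, z + h t y - (C x - D u)⟫_ℝ = ⟪u, z + h t y - C x⟫_ℝ + ⟪D u, u⟫_ℝ := by
    rw [real_inner_comm u (D u), ← inner_add_right]
    congr 1
    abel
  rw [h4] at hzv
  have h5 := neg_le_of_abs_le (abs_real_inner_le_norm u (z + h t y - C x))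
  have h6 : ‖z + h t y - C x‖ ≤ (‖z₀‖ + L * T + ‖h 0 0‖ + L * (T + 1) + ‖C‖) * μ := by
    have e1 : ‖C x‖ ≤ ‖C‖ * μ := (C.le_opNorm x).trans (by gcongr; linarith)
    have e2 : ‖z + h t y - C x‖ ≤ ‖z‖ + ‖h t y‖ + ‖C x‖ :=
      (norm_sub_le _ _).trans (by gcongr; exact norm_add_le _ _)
    have e3 : ‖z₀‖ + L * T + ‖h 0 0‖ + L * T ≤ (‖z₀‖ + L * T + ‖h 0 0‖ + L * T) * μ :=
      le_mul_of_one_le_right (by positivity) hμ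
    linarith
  rw [div_mul_eq_mul_div, le_div_iff₀ hc]
  refine le_trans ?_ h6
  rcases (norm_nonneg u).eq_or_lt with h0 | h0
  · rw [← h0, zero_mul]; exact norm_nonneg _
  · nlinarith

/-- The implicit Euler scheme is solvable and bounded, uniformly in the step size. -/
lemma exists_discrete (S : IsSweepingData C D K₁ h T L) (hT : 0 < T)
    (H : IsPassiveTriple B C D P α c) {f : ℝ → Euc n → Euc n} {Af : ℝ} (hAf : 0 ≤ Af)
    (hf : ∀ t ∈ Icc 0 T, ∀ x, ‖f t x‖ ≤ Af * (1 + ‖x‖)) {x₀ : Euc n} {u₀ : Euc m}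
    (hu₀ : u₀ ∈ symRange D)
    (hn₀ : u₀ ∈ normalConeAt ((K₁ 0 ∩ range C) + {h 0 x₀}) (C x₀ - D u₀)) :
    ∃ V : ℝ, 0 ≤ V ∧ ∃ τ₀ : ℝ, 0 < τ₀ ∧ ∀ N : ℕ, 0 < N → T / N ≤ τ₀ →
      ∃ (X : ℕ → Euc n) (v : ℕ → Euc m), X 0 = x₀ ∧
        IsEulerScheme f B C D K₁ h (T / N) V N X v := by
  have hL := S.lip_nonneg
  have hα := H.alpha_pos
  have hc := H.c_pos
  obtain ⟨Au, hAu, hu⟩ := S.exists_multiplier_bound hT.le H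
  obtain ⟨Λ, hΛ, hstep⟩ := H.exists_step_bound hL (A := Af + Au) (by positivity)
  set F := P.comp B - ContinuousLinearMap.adjoint C
  set μM := (1 + ‖x₀‖) * Real.exp (Λ * T) with hμM
  have hμM0 : 0 < μM := by positivity
  set τ₀ := min 1 (min (α * c / (2 * ‖F‖ ^ 2 + 1)) (1 / ((L * (1 + Λ)) ^ 2 + 1))) with hτ₀
  have hτ₀0 : 0 < τ₀ := by
    refine lt_min one_pos (lt_min ?_ ?_) <;> positivity
  refine ⟨(1 + Λ) * μM + ‖u₀‖, by positivity, τ₀, hτ₀0, ?_⟩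
  intro N hN hτN
  have hN' : (0 : ℝ) < N := by exact_mod_cast hN
  set τ := T / N with hτ
  have hτ0 : 0 < τ := by positivity
  have hτ1 : τ ≤ 1 := hτN.trans (min_le_left _ _)
  have hτF : 2 * (τ * ‖F‖ ^ 2) ≤ α * c := by
    have h1 : τ ≤ α * c / (2 * ‖F‖ ^ 2 + 1) :=
      hτN.trans ((min_le_right _ _).trans (min_le_left _ _))
    rw [le_div_iff₀ (by positivity)] at h1
    linarith
  have hτL : τ * (L * (1 + Λ)) ^ 2 ≤ 1 := by
    have h1 : τ ≤ 1 / ((L * (1 + Λ)) ^ 2 + 1) :=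
      hτN.trans ((min_le_right _ _).trans (min_le_right _ _))
    rw [le_div_iff₀ (by positivity)] at h1
    linarith
  have hti0 : ∀ i : ℕ, 0 ≤ (i : ℝ) * τ := fun i => by positivity
  have htiT : ∀ i : ℕ, i ≤ N → (i : ℝ) * τ ∈ Icc 0 T := by
    intro i hi
    refine ⟨hti0 i, ?_⟩
    have h1 : (i : ℝ) ≤ N := by exact_mod_cast hi
    calc (i : ℝ) * τ ≤ N * τ := by gcongr
      _ = T := by rw [hτ]; field_simp
  have hchoice : ∀ (i : ℕ) (x : Euc n), ∃ v ∈ C.range,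
      v ∈ normalConeAt ((K₁ ((i + 1 : ℕ) * τ) ∩ range C) + {h ((i + 1 : ℕ) * τ) x})
        (C (x + τ • (f (i * τ) x - B v)) - D v) := fun i x =>
    H.exists_step hτ0 (by nlinarith [mul_nonneg hτ0.le (sq_nonneg ‖F‖)])
      (S.nonempty _ (hti0 _)) (S.isClosed _ (hti0 _)) (S.convex _ (hti0 _)) inter_subset_right
      (S.trans_mem _ (hti0 _) x) x (f (i * τ) x)
  choose w hwR hw using hchoice
  let X : ℕ → Euc n := fun k => Nat.rec x₀ (fun i x => x + τ • (f (i * τ) x - B (w i x))) k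
  -- Index `0` carries the given initial multiplier; with `0 - 1 = 0` in `ℕ`, its translation is `h
  -- 0 x₀`.
  let v : ℕ → Euc m := fun k => Nat.casesOn k u₀ fun i => w i (X i)
  have hX : ∀ i, X (i + 1) = X i + τ • (f (i * τ) (X i) - B (v (i + 1))) := fun i => rfl
  have hvR : ∀ i, v (i + 1) ∈ C.range := fun i => hwR i (X i)
  have hv : ∀ i, v (i + 1) ∈
      normalConeAt ((K₁ ((i + 1 : ℕ) * τ) ∩ range C) + {h ((i + 1 : ℕ) * τ) (X i)})
        (C (X (i + 1)) - D (v (i + 1))) := fun i => hw i (X i)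
  -- The discrete Grönwall majorant of `1 + ‖X i‖`.
  let μ : ℕ → ℝ := fun i => (1 + ‖x₀‖) * (1 + Λ * τ) ^ i
  have hμ1 : ∀ i, 1 ≤ μ i := by
    intro i
    have h1 : 1 ≤ (1 + Λ * τ) ^ i := one_le_pow₀ (by have := mul_nonneg hΛ hτ0.le; linarith)
    have h2 := norm_nonneg x₀
    nlinarith
  have hμs : ∀ i, μ (i + 1) = μ i + Λ * τ * μ i := fun i => by simp only [μ, pow_succ]; ring
  have hμmono : ∀ i, μ i ≤ μ (i + 1) := by
    intro i
    rw [hμs]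
    have : 0 ≤ Λ * τ * μ i := by have := hμ1 i; positivity
    linarith
  have hμM' : ∀ i ≤ N, μ i ≤ μM := by
    intro i hi
    refine mul_le_mul_of_nonneg_left ?_ (by positivity)
    calc (1 + Λ * τ) ^ i ≤ Real.exp (Λ * τ) ^ i := by
          gcongr
          rw [add_comm]
          exact Real.add_one_le_exp _
      _ = Real.exp (Λ * (i * τ)) := by rw [← Real.exp_nat_mul]; congr 1; ring
      _ ≤ Real.exp (Λ * T) := by
          gcongr
          exact (htiT i hi).2
  have hstep' : ∀ i < N, ∀ u ∈ symRange D, 1 + ‖X i‖ ≤ μ i → 1 + ‖X (i - 1)‖ ≤ μ i →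
      ‖X i - X (i - 1)‖ ≤ Λ * τ * μ i →
      u ∈ normalConeAt ((K₁ (i * τ) ∩ range C) + {h (i * τ) (X (i - 1))}) (C (X i) - D u) →
      ‖f (i * τ) (X i) - B (v (i + 1))‖ ≤ Λ * μ i ∧ ‖v (i + 1)‖ ≤ Λ * μ i := by
    intro i hi u huS hXi hXi' hdX hun
    have hμi := hμ1 i
    have hsub : ((i + 1 : ℕ) : ℝ) * τ - i * τ = τ := by push_cast; ring
    have hsub' : (i : ℝ) * τ - (i + 1 : ℕ) * τ = -τ := by push_cast; ring
    -- The translation rate `d` comes from the previous increment: `L (τ + ‖X i - X (i - 1)‖) ≤ τ L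
    -- (1 + Λ) μ i`.
    refine hstep τ (μ i) (L * (1 + Λ) * μ i) _ _ _ _ u _ (X i) _ hτ0 hτ1 hτF hμi ?_ ?_
      (S.trans_mem _ (hti0 _) (X (i - 1))) (S.trans_mem _ (hti0 _) (X i)) ?_ (by positivity) ?_
      huS (hvR i) ?_ ?_ hun (hv i)
    · intro a ha
      obtain ⟨b, hb, hab⟩ := S.near _ _ (hti0 i) (hti0 (i + 1)) a ha
      rw [hsub', abs_neg, abs_of_pos hτ0] at hab
      exact ⟨b, hb, hab⟩
    · intro a ha
      obtain ⟨b, hb, hab⟩ := S.near _ _ (hti0 (i + 1)) (hti0 i) a ha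
      rw [hsub, abs_of_pos hτ0] at hab
      exact ⟨b, hb, hab⟩
    · refine (S.trans_lip _ _ (hti0 _) (hti0 _) _ _).trans ?_
      rw [hsub, abs_of_pos hτ0]
      calc L * (τ + ‖X i - X (i - 1)‖) ≤ L * (τ * μ i + Λ * τ * μ i) := by
            gcongr
            exact le_mul_of_one_le_right hτ0.le hμi
        _ = τ * (L * (1 + Λ) * μ i) := by ring
    · calc τ * (L * (1 + Λ) * μ i) ^ 2 = τ * (L * (1 + Λ)) ^ 2 * μ i ^ 2 := by ring
        _ ≤ 1 * μ i ^ 2 := by gcongr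
        _ = μ i ^ 2 := one_mul _
    · refine (hf _ (htiT i hi.le) _).trans ?_
      calc Af * (1 + ‖X i‖) ≤ Af * μ i := by gcongr
        _ ≤ (Af + Au) * μ i := by gcongr; linarith
    · refine (hu _ (htiT i hi.le) _ _ u (μ i) hXi hXi' huS hun).trans ?_
      gcongr; linarith
  -- The invariant carries a multiplier in `rge (D + Dᵀ)`, renewed by `S.meet` and bounded linearly
  -- by the state; bounding `v (i + 1)` through `v i` would compound.
  have hinv : ∀ i ≤ N, ‖X i - X (i - 1)‖ ≤ Λ * τ * μ i ∧ 1 + ‖X i‖ ≤ μ i ∧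
      1 + ‖X (i - 1)‖ ≤ μ i ∧ ∃ u ∈ symRange D,
        u ∈ normalConeAt ((K₁ (i * τ) ∩ range C) + {h (i * τ) (X (i - 1))}) (C (X i) - D u) := by
    intro i
    induction i with
    | zero =>
      intro _
      refine ⟨?_, ?_, ?_, u₀, hu₀, ?_⟩
      · have := hμ1 0
        simp only [zero_tsub, sub_self, norm_zero]
        positivity
      · simp [X, μ]
      · simp [X, μ]
      · simpa [X] using hn₀
    | succ i ih =>
      intro hi
      obtain ⟨h1, h2, h3, u, huS, hun⟩ := ih (by omega)
      obtain ⟨h4, h5⟩ := hstep' i (by omega) u huS h2 h3 h1 hun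
      have hd : ‖X (i + 1) - X i‖ ≤ Λ * τ * μ i := by
        rw [hX, add_sub_cancel_left, norm_smul, Real.norm_of_nonneg hτ0.le]
        calc τ * _ ≤ τ * (Λ * μ i) := by gcongr
          _ = _ := by ring
      rw [Nat.add_sub_cancel]
      refine ⟨hd.trans (by gcongr; exact hμmono i), ?_, h2.trans (hμmono i),
        S.meet _ (htiT (i + 1) hi) (X (i + 1)) (X i) _ (hvR i) (hv i)⟩
      rw [hμs]
      have := norm_le_norm_add_norm_sub' (X (i + 1)) (X i)
      linarith
  refine ⟨X, v, rfl, fun i _ => hX i, fun i hi => ?_, fun i hi => ?_⟩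
  · obtain ⟨-, h2, -, -⟩ := hinv i hi
    have hXi : ‖X i‖ ≤ (1 + Λ) * μM + ‖u₀‖ := by
      have e1 := hμM' i hi
      have e2 : 0 ≤ Λ * μM := by positivity
      have e3 := norm_nonneg u₀
      linarith
    rcases i with _ | i
    · refine ⟨symRange_le_range H.monotone H.range_subset hu₀, ?_, hXi, ?_⟩
      · have : 0 ≤ (1 + Λ) * μM := by positivity
        change ‖u₀‖ ≤ _
        linarith
      · simpa [X, v] using hn₀
    · refine ⟨hvR i, ?_, hXi, hv i⟩
      obtain ⟨h1, h2, h3, u, huS, hun⟩ := hinv i (by omega)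
      obtain ⟨-, h5⟩ := hstep' i (by omega) u huS h2 h3 h1 hun
      have e1 : Λ * μ i ≤ Λ * μM := by gcongr; exact hμM' i (by omega)
      have e3 := norm_nonneg u₀
      linarith
  · obtain ⟨h1, h2, h3, u, huS, hun⟩ := hinv i hi.le
    obtain ⟨h4, -⟩ := hstep' i hi u huS h2 h3 h1 hun
    rw [hX, add_sub_cancel_left, norm_smul, Real.norm_of_nonneg hτ0.le, mul_comm]
    gcongr
    have e1 : Λ * μ i ≤ Λ * μM := by gcongr; exact hμM' i hi.le
    have e3 := norm_nonneg u₀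
    linarith

end IsSweepingData

/-! ### Approximate multipliers and their averages -/

/-- The multipliers in `rge C`, bounded by `V`, which satisfy the normal cone condition for the set
`Q + h` at `w - D v` up to an error `ε`. -/
def approxMultipliers {n m : ℕ} (C : Euc n →L[ℝ] Euc m) (D : Euc m →L[ℝ] Euc m) (Q : Set (Euc m))
    (h w : Euc m) (V ε : ℝ) : Set (Euc m) :=
  {v | v ∈ C.range ∧ ‖v‖ ≤ V ∧ (∃ z ∈ Q, ‖w - D v - h - z‖ ≤ ε) ∧
    ∀ z ∈ Q, ⟪v, z + h - w⟫_ℝ + ⟪D v, v⟫_ℝ ≤ ε}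

section ApproxMultipliers

variable {n m : ℕ} {C : Euc n →L[ℝ] Euc m} {D : Euc m →L[ℝ] Euc m} {Q : Set (Euc m)}
  {h w : Euc m} {V ε : ℝ}

/-- The normality defect at `w - D v` is affine in `v` plus `⟪D v, v⟫`, a convex function for
monotone `D`; distance to the convex set `Q` is preserved by averaging too. -/
lemma convex_approxMultipliers (hD : ∀ v, 0 ≤ ⟪D v, v⟫_ℝ) (hQ : Convex ℝ Q) :
    Convex ℝ (approxMultipliers C D Q h w V ε) := by
  rintro v₁ ⟨h1, h2, ⟨z₁, hz₁, h3⟩, h4⟩ v₂ ⟨k1, k2, ⟨z₂, hz₂, k3⟩, k4⟩ a b ha hb hab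
  refine ⟨C.range.add_mem (C.range.smul_mem _ h1) (C.range.smul_mem _ k1), ?_, ?_, ?_⟩
  · calc ‖a • v₁ + b • v₂‖ ≤ a * ‖v₁‖ + b * ‖v₂‖ := by
          refine (norm_add_le _ _).trans ?_
          rw [norm_smul, norm_smul, Real.norm_of_nonneg ha, Real.norm_of_nonneg hb]
      _ ≤ a * V + b * V := by gcongr
      _ = V := by rw [← add_mul, hab, one_mul]
  · refine ⟨a • z₁ + b • z₂, hQ hz₁ hz₂ ha hb hab, ?_⟩
    have e1 : w - D (a • v₁ + b • v₂) - h - (a • z₁ + b • z₂) =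
        a • (w - D v₁ - h - z₁) + b • (w - D v₂ - h - z₂) := by
      have hw : w = a • w + b • w := by rw [← add_smul, hab, one_smul]
      have hh : h = a • h + b • h := by rw [← add_smul, hab, one_smul]
      nth_rw 1 [hw, hh]
      simp only [map_add, map_smul, smul_sub]
      abel
    rw [e1]
    calc _ ≤ a * ‖w - D v₁ - h - z₁‖ + b * ‖w - D v₂ - h - z₂‖ := by
          refine (norm_add_le _ _).trans ?_
          rw [norm_smul, norm_smul, Real.norm_of_nonneg ha, Real.norm_of_nonneg hb]
      _ ≤ a * ε + b * ε := by gcongr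
      _ = ε := by rw [← add_mul, hab, one_mul]
  · intro z hz
    have e1 := h4 z hz
    have e2 := k4 z hz
    have e3 : ⟪D (a • v₁ + b • v₂), a • v₁ + b • v₂⟫_ℝ =
        a * ⟪D v₁, v₁⟫_ℝ + b * ⟪D v₂, v₂⟫_ℝ - a * b * ⟪D (v₁ - v₂), v₁ - v₂⟫_ℝ := by
      obtain rfl : b = 1 - a := by linarith
      simp only [map_add, map_smul, map_sub, inner_add_left, inner_add_right, inner_sub_left,
        inner_sub_right, real_inner_smul_left, real_inner_smul_right]
      ring
    rw [e3, inner_add_left, real_inner_smul_left, real_inner_smul_left]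
    have e4 := mul_nonneg (mul_nonneg ha hb) (hD (v₁ - v₂))
    have e5 : a * (⟪v₁, z + h - w⟫_ℝ + ⟪D v₁, v₁⟫_ℝ) ≤ a * ε := by gcongr
    have e6 : b * (⟪v₂, z + h - w⟫_ℝ + ⟪D v₂, v₂⟫_ℝ) ≤ b * ε := by gcongr
    have e7 : a * ε + b * ε = ε := by rw [← add_mul, hab, one_mul]
    linarith

/-- Bounded approximate multipliers subconverge and all conditions are closed. The equation `p = B
v` is carried along so that it holds for the same limit; `k = 0` makes it void. -/
lemma exists_multiplier_of_approx (hQc : IsClosed Q) {k : ℕ} (B : Euc m →L[ℝ] Euc k) (p : Euc k)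
    (H : ∀ ε > 0, ∃ u ∈ approxMultipliers C D Q h w V ε, ‖p - B u‖ ≤ ε) :
    ∃ v ∈ C.range, v ∈ normalConeAt (Q + {h}) (w - D v) ∧ p = B v := by
  have hpos : ∀ j : ℕ, (0 : ℝ) < 1 / ((j : ℝ) + 1) := fun j => by positivity
  choose u hu hup using fun j : ℕ => H _ (hpos j)
  obtain ⟨v, -, φ, hφ, hlim⟩ := (isCompact_closedBall (0 : Euc m) V).tendsto_subseq
    (fun j => mem_closedBall_zero_iff.2 (hu j).2.1)
  have hε : Filter.Tendsto (fun j => 1 / ((φ j : ℝ) + 1)) Filter.atTop (nhds 0) :=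
    tendsto_one_div_add_atTop_nhds_zero_nat.comp hφ.tendsto_atTop
  refine ⟨v, ?_, ⟨?_, ?_⟩, ?_⟩
  · exact C.range.closed_of_finiteDimensional.mem_of_tendsto hlim
      (Filter.Eventually.of_forall fun j => (hu _).1)
  · choose z hz hzn using fun j => (hu (φ j)).2.2.1
    have h1 : Filter.Tendsto (fun j => w - D (u (φ j)) - h) Filter.atTop (nhds (w - D v - h)) :=
      ((tendsto_const_nhds.sub ((D.continuous.tendsto v).comp hlim)).sub tendsto_const_nhds)
    have h2 : Filter.Tendsto (fun j => w - D (u (φ j)) - h - z j) Filter.atTop (nhds 0) :=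
      squeeze_zero_norm hzn hε
    have h3 := h1.sub h2
    simp only [sub_sub_cancel, sub_zero] at h3
    have h4 : w - D v - h ∈ Q := hQc.mem_of_tendsto h3 (Filter.Eventually.of_forall hz)
    exact mem_add_singleton_iff.2 ⟨_, h4, by abel⟩
  · intro y hy
    obtain ⟨z, hz, rfl⟩ := mem_add_singleton_iff.1 hy
    have h1 : Filter.Tendsto (fun j => ⟪u (φ j), z + h - w⟫_ℝ + ⟪D (u (φ j)), u (φ j)⟫_ℝ)
        Filter.atTop (nhds (⟪v, z + h - w⟫_ℝ + ⟪D v, v⟫_ℝ)) :=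
      (hlim.inner tendsto_const_nhds).add (((D.continuous.tendsto v).comp hlim).inner hlim)
    have h2 := le_of_tendsto_of_tendsto' h1 hε fun j => (hu (φ j)).2.2.2 z hz
    have h3 : z + h - (w - D v) = (z + h - w) + D v := by abel
    rw [h3, inner_add_right, real_inner_comm (D v)]
    exact h2
  · have h1 : Filter.Tendsto (fun j => p - B (u (φ j))) Filter.atTop (nhds (p - B v)) :=
      tendsto_const_nhds.sub ((B.continuous.tendsto v).comp hlim)
    have h2 : Filter.Tendsto (fun j => p - B (u (φ j))) Filter.atTop (nhds 0) :=
      squeeze_zero_norm (fun j => hup _) hε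
    exact sub_eq_zero.1 (tendsto_nhds_unique h1 h2)

end ApproxMultipliers

namespace IsEulerScheme

variable {n m : ℕ} {f : ℝ → Euc n → Euc n} {B : Euc m →L[ℝ] Euc n} {C : Euc n →L[ℝ] Euc m}
  {D : Euc m →L[ℝ] Euc m} {K₁ : ℝ → Set (Euc m)} {h : ℝ → Euc n → Euc m} {T L τ V : ℝ} {N : ℕ}
  {X : ℕ → Euc n} {v : ℕ → Euc m}

lemma norm_sub_le (E : IsEulerScheme f B C D K₁ h τ V N X v) {i j : ℕ} (hij : i ≤ j) (hj : j ≤ N) :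
    ‖X j - X i‖ ≤ V * ((j - i : ℝ) * τ) := by
  induction j, hij using Nat.le_induction with
  | base => simp
  | succ j hij ih =>
    have h1 := ih (by omega)
    have h2 := E.velocity j (by omega)
    calc ‖X (j + 1) - X i‖ ≤ ‖X (j + 1) - X j‖ + ‖X j - X i‖ := norm_sub_le_norm_sub_add_norm_sub _ _ _
      _ ≤ V * τ + V * ((j - i : ℝ) * τ) := by gcongr
      _ = _ := by push_cast; ring

/-- Freezing the data at `(t₀, x₀)` moves the set by `L δ`, the translation by `2 L δ` and `C x` by
`‖C‖ δ`. The factor `1 + V` serves both the distance and the pairing with `‖v i‖ ≤ V`. -/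
lemma multiplier_mem_approx (E : IsEulerScheme f B C D K₁ h τ V N X v)
    (S : IsSweepingData C D K₁ h T L) (hτ : 0 ≤ τ) (hV : 0 ≤ V) {t₀ : ℝ} (ht₀ : 0 ≤ t₀)
    {x₀ : Euc n} {δ : ℝ} {i : ℕ} (hi : i ≤ N) (hti : |i * τ - t₀| ≤ δ) (hX : ‖X i - x₀‖ ≤ δ)
    (hX' : ‖X (i - 1) - x₀‖ ≤ δ) :
    v i ∈ approxMultipliers C D (K₁ t₀ ∩ range C) (h t₀ x₀) (C x₀) V
      ((1 + V) * (‖C‖ + 3 * L) * δ) := by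
  have hL := S.lip_nonneg
  have hδ : 0 ≤ δ := (abs_nonneg _).trans hti
  obtain ⟨h1, h2, -, hy, hn⟩ := E.multiplier i hi
  have hti0 : 0 ≤ (i : ℝ) * τ := by positivity
  have hhd : ‖h (i * τ) (X (i - 1)) - h t₀ x₀‖ ≤ L * (2 * δ) :=
    (S.trans_lip _ _ hti0 ht₀ _ _).trans (by gcongr; linarith)
  have hCd : ‖C (X i - x₀)‖ ≤ ‖C‖ * δ := (C.le_opNorm _).trans (by gcongr)
  refine ⟨h1, h2, ?_, fun z hz => ?_⟩
  · obtain ⟨a, ha, hya⟩ := mem_add_singleton_iff.1 hy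
    obtain ⟨z, hz, haz⟩ := S.near _ _ hti0 ht₀ a ha
    refine ⟨z, hz, ?_⟩
    have e1 : C x₀ - D (v i) - h t₀ x₀ - z =
        (a - z) + (h (i * τ) (X (i - 1)) - h t₀ x₀) - C (X i - x₀) := by
      rw [map_sub]
      have : D (v i) = C (X i) - (a + h (i * τ) (X (i - 1))) := by rw [← hya]; abel
      rw [this]
      abel
    rw [e1]
    calc _ ≤ ‖a - z‖ + ‖h (i * τ) (X (i - 1)) - h t₀ x₀‖ + ‖C (X i - x₀)‖ :=
          (_root_.norm_sub_le _ _).trans (by gcongr; exact norm_add_le _ _)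
      _ ≤ L * δ + L * (2 * δ) + ‖C‖ * δ := by
          gcongr
          exact haz.trans (by gcongr)
      _ = 1 * (‖C‖ + 3 * L) * δ := by ring
      _ ≤ _ := by gcongr; linarith
  · obtain ⟨b, hb, hzb⟩ := S.near _ _ ht₀ hti0 z hz
    have k := hn _ (add_mem_add hb rfl)
    have e1 : ⟪v i, z + h t₀ x₀ - C x₀⟫_ℝ + ⟪D (v i), v i⟫_ℝ =
        ⟪v i, b + h (i * τ) (X (i - 1)) - (C (X i) - D (v i))⟫_ℝ +
        ⟪v i, (z - b) - (h (i * τ) (X (i - 1)) - h t₀ x₀) + C (X i - x₀)⟫_ℝ := by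
      rw [real_inner_comm (v i), ← inner_add_right, ← inner_add_right, map_sub]
      congr 1
      abel
    rw [e1]
    have e2 : ‖(z - b) - (h (i * τ) (X (i - 1)) - h t₀ x₀) + C (X i - x₀)‖ ≤
        (‖C‖ + 3 * L) * δ := by
      calc _ ≤ ‖z - b‖ + ‖h (i * τ) (X (i - 1)) - h t₀ x₀‖ + ‖C (X i - x₀)‖ :=
            (norm_add_le _ _).trans (by gcongr; exact _root_.norm_sub_le _ _)
        _ ≤ L * δ + L * (2 * δ) + ‖C‖ * δ := by
            gcongr
            exact hzb.trans (by rw [abs_sub_comm]; gcongr)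
        _ = _ := by ring
    have e3 := (real_inner_le_norm (v i) _).trans (mul_le_mul h2 e2 (norm_nonneg _) hV)
    have e4 : V * ((‖C‖ + 3 * L) * δ) ≤ (1 + V) * (‖C‖ + 3 * L) * δ := by
      rw [mul_assoc]
      gcongr
      linarith
    linarith

/-- The increments of the scheme are driven by averaged multipliers. -/
lemma exists_average (E : IsEulerScheme f B C D K₁ h τ V N X v)
    (S : IsSweepingData C D K₁ h T L) (hD : ∀ v, 0 ≤ ⟪D v, v⟫_ℝ) (hτ : 0 ≤ τ) (hV : 0 ≤ V)
    {t₀ : ℝ} (ht₀ : 0 ≤ t₀) {x₀ : Euc n} {δ ε : ℝ} {i j : ℕ} (hij : i < j) (hj : j ≤ N)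
    (hnear : ∀ l, i ≤ l → l ≤ j → |l * τ - t₀| ≤ δ ∧ ‖X l - x₀‖ ≤ δ)
    (hf : ∀ l, i ≤ l → l < j → ‖f (l * τ) (X l) - f t₀ x₀‖ ≤ ε) :
    ∃ u ∈ approxMultipliers C D (K₁ t₀ ∩ range C) (h t₀ x₀) (C x₀) V
        ((1 + V) * (‖C‖ + 3 * L) * δ),
      ‖X j - X i - ((j - i : ℝ) * τ) • (f t₀ x₀ - B u)‖ ≤ (j - i : ℝ) * τ * ε := by
  have hij' : (0 : ℝ) < j - i := by
    have : (i : ℝ) < j := by exact_mod_cast hij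
    linarith
  have hcard : ((Finset.Ico i j).card : ℝ) = j - i := by
    rw [Nat.card_Ico, Nat.cast_sub hij.le]
  -- The shift `l + 1` reflects implicitness: the step from `l` to `l + 1` uses the multiplier at
  -- its end.
  refine ⟨∑ l ∈ Finset.Ico i j, ((j - i : ℝ)⁻¹) • v (l + 1), ?_, ?_⟩
  · refine (convex_approxMultipliers hD (S.convex t₀ ht₀)).sum_mem (fun _ _ => by positivity) ?_ ?_
    · rw [Finset.sum_const, nsmul_eq_mul, hcard]
      field_simp
    · intro l hl
      rw [Finset.mem_Ico] at hl
      have h1 := hnear (l + 1) (by omega) (by omega)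
      have h2 := hnear l hl.1 hl.2.le
      exact E.multiplier_mem_approx S hτ hV ht₀ (by omega) h1.1 h1.2 h2.2
  · have h1 : X j - X i = ∑ l ∈ Finset.Ico i j, τ • (f (l * τ) (X l) - B (v (l + 1))) := by
      rw [← Finset.sum_Ico_sub (f := X) hij.le]
      refine Finset.sum_congr rfl fun l hl => ?_
      rw [Finset.mem_Ico] at hl
      rw [E.step l (by omega), add_sub_cancel_left]
    have h2 : ((j - i : ℝ) * τ) • (f t₀ x₀ - B (∑ l ∈ Finset.Ico i j, ((j - i : ℝ)⁻¹) • v (l + 1))) =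
        ∑ l ∈ Finset.Ico i j, τ • (f t₀ x₀ - B (v (l + 1))) := by
      rw [← Finset.smul_sum, ← Finset.smul_sum, Finset.sum_sub_distrib, Finset.sum_const,
        ← Nat.cast_smul_eq_nsmul ℝ, hcard, map_smul, map_sum, mul_comm, mul_smul, smul_sub,
        smul_smul, mul_inv_cancel₀ hij'.ne', one_smul]
    rw [h1, h2, ← Finset.sum_sub_distrib]
    refine (norm_sum_le _ _).trans ?_
    calc _ ≤ ∑ l ∈ Finset.Ico i j, τ * ε := by
          refine Finset.sum_le_sum fun l hl => ?_
          rw [Finset.mem_Ico] at hl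
          rw [← smul_sub, sub_sub_sub_cancel_right, norm_smul, Real.norm_of_nonneg hτ]
          gcongr
          exact hf l hl.1 hl.2
      _ = (j - i : ℝ) * τ * ε := by
          rw [Finset.sum_const, nsmul_eq_mul, hcard]; ring

end IsEulerScheme

lemma approxMultipliers_mono {n m : ℕ} {C : Euc n →L[ℝ] Euc m} {D : Euc m →L[ℝ] Euc m}
    {Q : Set (Euc m)} {h w : Euc m} {V ε ε' : ℝ} (hε : ε ≤ ε') :
    approxMultipliers C D Q h w V ε ⊆ approxMultipliers C D Q h w V ε' := by
  rintro v ⟨h1, h2, ⟨z, hz, h3⟩, h4⟩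
  exact ⟨h1, h2, ⟨z, hz, h3.trans hε⟩, fun z hz => (h4 z hz).trans hε⟩

/-! ### Passage to the limit -/

/-- The index of the grid point of step `T / N` below `t`. -/
noncomputable def gridIndex (T : ℝ) (N : ℕ) (t : ℝ) : ℕ := ⌊t / (T / N)⌋₊

section GridIndex

variable {T t : ℝ} {N : ℕ}

lemma gridIndex_mul_le (hT : 0 < T) (hN : 0 < N) (ht : 0 ≤ t) :
    (gridIndex T N t : ℝ) * (T / N) ≤ t := by
  have : (0 : ℝ) < N := by exact_mod_cast hN
  have hτ : 0 < T / N := by positivity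
  rw [← le_div_iff₀ hτ]
  exact Nat.floor_le (by positivity)

lemma lt_gridIndex_mul_add (hT : 0 < T) (hN : 0 < N) :
    t < (gridIndex T N t : ℝ) * (T / N) + T / N := by
  have : (0 : ℝ) < N := by exact_mod_cast hN
  have hτ : 0 < T / N := by positivity
  have h1 : t / (T / N) < gridIndex T N t + 1 := Nat.lt_floor_add_one _
  rw [div_lt_iff₀ hτ] at h1
  linarith

lemma gridIndex_le (hT : 0 < T) (hN : 0 < N) (ht : t ∈ Icc 0 T) : gridIndex T N t ≤ N := by
  have hN' : (0 : ℝ) < N := by exact_mod_cast hN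
  have hτ : 0 < T / N := by positivity
  have h1 := (gridIndex_mul_le hT hN ht.1).trans ht.2
  have h2 : (N : ℝ) * (T / N) = T := by field_simp
  have h3 : (gridIndex T N t : ℝ) ≤ N := by
    refine le_of_mul_le_mul_right ?_ hτ
    linarith
  exact_mod_cast h3

lemma gridIndex_mono (hT : 0 < T) {s : ℝ} (hst : s ≤ t) : gridIndex T N s ≤ gridIndex T N t :=
  Nat.floor_mono (by gcongr)

end GridIndex

/-- Limits along one ultrafilter exist at all times simultaneously, so no diagonal extraction is
needed. -/
lemma eventually_hyperfilter {p : ℕ → Prop} (h : ∀ᶠ N in Filter.atTop, p N) :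
    ∀ᶠ N in (Filter.hyperfilter ℕ : Filter ℕ), p N := by
  have : (Filter.hyperfilter ℕ : Filter ℕ) ≤ Filter.atTop := by
    rw [← Nat.cofinite_eq_atTop]
    exact Filter.hyperfilter_le_cofinite
  exact this h

lemma eventually_step_le (T : ℝ) {ε : ℝ} (hε : 0 < ε) :
    ∀ᶠ N : ℕ in Filter.atTop, T / N ≤ ε :=
  (tendsto_const_div_atTop_nhds_zero_nat T).eventually_le_const hε

section Limit

variable {n m : ℕ} {f : ℝ → Euc n → Euc n} {B : Euc m →L[ℝ] Euc n} {C : Euc n →L[ℝ] Euc m}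
  {D : Euc m →L[ℝ] Euc m} {K₁ : ℝ → Set (Euc m)} {h : ℝ → Euc n → Euc m} {T L V : ℝ}
  {X : ℕ → ℕ → Euc n} {v : ℕ → ℕ → Euc m} {x : ℝ → Euc n}

/-- The discrete solutions converge along an ultrafilter to a Lipschitz function. -/
lemma exists_limit_scheme (hT : 0 < T) (hV : 0 ≤ V)
    (E : ∀ᶠ N : ℕ in Filter.atTop, IsEulerScheme f B C D K₁ h (T / N) V N (X N) (v N)) :
    ∃ x : ℝ → Euc n, LipschitzWith V.toNNReal x ∧ ∀ t ∈ Icc 0 T,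
      Filter.Tendsto (fun N => X N (gridIndex T N t)) (Filter.hyperfilter ℕ) (nhds (x t)) := by
  have E' := eventually_hyperfilter (E.and (Filter.eventually_gt_atTop 0))
  have hlim : ∀ t : Icc 0 T, ∃ y,
      Filter.Tendsto (fun N => X N (gridIndex T N t)) (Filter.hyperfilter ℕ) (nhds y) := by
    intro t
    have hb : ∀ᶠ N in (Filter.hyperfilter ℕ : Filter ℕ),
        X N (gridIndex T N t) ∈ closedBall (0 : Euc n) V := by
      filter_upwards [E'] with N hN
      exact mem_closedBall_zero_iff.2 (hN.1.multiplier _ (gridIndex_le hT hN.2 t.2)).2.2.1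
    obtain ⟨y, -, hy⟩ := (isCompact_closedBall (0 : Euc n) V).ultrafilter_le_nhds
      ((Filter.hyperfilter ℕ).map fun N => X N (gridIndex T N t)) (Filter.le_principal_iff.2 hb)
    exact ⟨y, hy⟩
  choose y hy using hlim
  have hle : ∀ s t : Icc 0 T, s ≤ t → ‖y t - y s‖ ≤ V * (t - s : ℝ) := by
    intro s t hst
    have h1 : Filter.Tendsto (fun N : ℕ => V * ((t - s : ℝ) + T / N)) (Filter.hyperfilter ℕ)
        (nhds (V * ((t - s : ℝ) + 0))) := by
      have hat : (Filter.hyperfilter ℕ : Filter ℕ) ≤ Filter.atTop := by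
        rw [← Nat.cofinite_eq_atTop]
        exact Filter.hyperfilter_le_cofinite
      exact ((tendsto_const_nhds.add (tendsto_const_div_atTop_nhds_zero_nat T)).const_mul V).mono_left
        hat
    rw [add_zero] at h1
    refine le_of_tendsto_of_tendsto ((hy t).sub (hy s)).norm h1 ?_
    filter_upwards [E'] with N hN
    refine (hN.1.norm_sub_le (gridIndex_mono hT hst) (gridIndex_le hT hN.2 t.2)).trans ?_
    gcongr
    have e1 := gridIndex_mul_le hT hN.2 t.2.1
    have e2 := lt_gridIndex_mul_add (t := s) hT hN.2
    linarith
  have hdist : ∀ s t : Icc 0 T, dist (y s) (y t) ≤ V * dist s t := by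
    intro s t
    rcases le_total (s : ℝ) t with hst | hst
    · rw [dist_comm, dist_eq_norm, dist_comm s t, Subtype.dist_eq, Real.dist_eq,
        abs_of_nonneg (sub_nonneg.2 hst)]
      exact hle s t hst
    · rw [dist_eq_norm, Subtype.dist_eq, Real.dist_eq, abs_of_nonneg (sub_nonneg.2 hst)]
      exact hle t s hst
  have hylip : LipschitzWith V.toNNReal y := LipschitzWith.of_dist_le_mul fun s t => by
    rw [Real.coe_toNNReal V hV]
    exact hdist s t
  refine ⟨fun t => y (projIcc 0 T hT.le t), ?_, fun t ht => ?_⟩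
  · have := hylip.comp (LipschitzWith.projIcc hT.le)
    rwa [mul_one] at this
  · simp only [projIcc_of_mem hT.le ht]
    exact hy ⟨t, ht⟩

lemma IsEulerScheme.norm_pred_sub_le {τ : ℝ} {N : ℕ} {Y : ℕ → Euc n} {u : ℕ → Euc m}
    (E : IsEulerScheme f B C D K₁ h τ V N Y u) (hτ : 0 ≤ τ) (hV : 0 ≤ V) {i : ℕ} (hi : i ≤ N) :
    ‖Y (i - 1) - Y i‖ ≤ V * τ := by
  rcases i with _ | i
  · simp only [zero_tsub, sub_self, norm_zero]
    positivity
  · rw [norm_sub_rev]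
    exact E.velocity i (by omega)

/-- The limit of the scheme satisfies the static inclusion at every time. -/
lemma exists_multiplier_limit (hT : 0 < T) (hV : 0 ≤ V) (S : IsSweepingData C D K₁ h T L)
    (E : ∀ᶠ N : ℕ in Filter.atTop, IsEulerScheme f B C D K₁ h (T / N) V N (X N) (v N))
    (hx : ∀ t ∈ Icc 0 T,
      Filter.Tendsto (fun N => X N (gridIndex T N t)) (Filter.hyperfilter ℕ) (nhds (x t)))
    {t : ℝ} (ht : t ∈ Icc 0 T) :
    ∃ u ∈ C.range, u ∈ normalConeAt ((K₁ t ∩ range C) + {h t (x t)}) (C (x t) - D u) := by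
  have hL := S.lip_nonneg
  suffices H : ∀ ε > 0, ∃ u ∈ approxMultipliers C D (K₁ t ∩ range C) (h t (x t)) (C (x t)) V ε,
      ‖(0 : Euc 0) - (0 : Euc m →L[ℝ] Euc 0) u‖ ≤ ε by
    obtain ⟨u, hu, hn, -⟩ := exists_multiplier_of_approx (S.isClosed t ht.1) _ _ H
    exact ⟨u, hu, hn⟩
  intro ε hε
  set κ := (1 + V) * (‖C‖ + 3 * L) with hκ
  have hκ0 : 0 ≤ κ := by positivity
  set δ := ε / (κ + 1) with hδ
  have hδ0 : 0 < δ := by positivity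
  have hκδ : κ * δ ≤ ε := by
    rw [hδ, mul_div_assoc', div_le_iff₀ (by positivity)]
    nlinarith
  have e1 := eventually_hyperfilter (eventually_step_le T (ε := δ / (2 * (1 + V))) (by positivity))
  have e2 := eventually_hyperfilter (E.and (Filter.eventually_gt_atTop 0))
  have e3 := (hx t ht).eventually (closedBall_mem_nhds _ (half_pos hδ0))
  obtain ⟨N, ⟨h1, h2, hN⟩, h3⟩ := ((e1.and e2).and e3).exists
  rw [dist_eq_norm] at h3
  have hτ0 : 0 ≤ T / (N : ℝ) := by positivity
  rw [le_div_iff₀ (by positivity)] at h1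
  have hVτ : 0 ≤ V * (T / (N : ℝ)) := by positivity
  set i := gridIndex T N t
  have hiN : i ≤ N := gridIndex_le hT hN ht
  have h4 := h2.norm_pred_sub_le hτ0 hV hiN
  refine ⟨v N i, approxMultipliers_mono hκδ
    (h2.multiplier_mem_approx S hτ0 hV ht.1 hiN ?_ ?_ ?_), by simpa using hε.le⟩
  · have k1 := gridIndex_mul_le hT hN ht.1
    have k2 := lt_gridIndex_mul_add (t := t) hT hN
    rw [abs_le]
    constructor <;> linarith
  · linarith
  · have := norm_sub_le_norm_sub_add_norm_sub (X N (i - 1)) (X N i) (x t)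
    linarith

/-- The limit of the scheme satisfies the differential inclusion where it is differentiable. -/
lemma exists_multiplier_limit_of_hasDerivAt (hT : 0 < T) (hV : 0 ≤ V)
    (S : IsSweepingData C D K₁ h T L) (hD : ∀ v, 0 ≤ ⟪D v, v⟫_ℝ)
    (hf : ∀ t ∈ Icc 0 T, ∀ y, ∀ ε > 0, ∃ δ > 0, ∀ s ∈ Icc 0 T, ∀ z, |s - t| ≤ δ → ‖z - y‖ ≤ δ →
      ‖f s z - f t y‖ ≤ ε)
    (E : ∀ᶠ N : ℕ in Filter.atTop, IsEulerScheme f B C D K₁ h (T / N) V N (X N) (v N))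
    (hx : ∀ t ∈ Icc 0 T,
      Filter.Tendsto (fun N => X N (gridIndex T N t)) (Filter.hyperfilter ℕ) (nhds (x t)))
    {t : ℝ} (ht : t ∈ Ioo 0 T) {p : Euc n} (hp : HasDerivAt x p t) :
    ∃ u ∈ C.range, u ∈ normalConeAt ((K₁ t ∩ range C) + {h t (x t)}) (C (x t) - D u) ∧
      f t (x t) - p = B u := by
  have hL := S.lip_nonneg
  have ht' : t ∈ Icc 0 T := Ioo_subset_Icc_self ht
  refine exists_multiplier_of_approx (V := V) (S.isClosed t ht.1.le) _ _ fun ε hε => ?_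
  set κ := (1 + V) * (‖C‖ + 3 * L) with hκ
  have hκ0 : 0 ≤ κ := by positivity
  -- The errors below add up to `(1 + 1/2 + 1/2 + 2 + 1) ε₁ η = ε η`.
  set ε₁ := ε / 5 with hε₁
  have hε₁0 : 0 < ε₁ := by positivity
  obtain ⟨δf, hδf0, hδf⟩ := hf t ht' (x t) ε₁ hε₁0
  set δ := min δf (ε / (κ + 1)) with hδ
  have hδ0 : 0 < δ := lt_min hδf0 (by positivity)
  have hκδ : κ * δ ≤ ε := by
    have h1 : δ ≤ ε / (κ + 1) := min_le_right _ _
    rw [le_div_iff₀ (by positivity)] at h1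
    linarith
  have hder := (hasDerivAt_iff_isLittleO.1 hp).def hε₁0
  obtain ⟨ρ, hρ0, hρ⟩ := Metric.eventually_nhds_iff.1 hder
  set r := δ / (4 * (1 + V)) with hr
  have hr0 : 0 < r := by positivity
  -- The window `η` is fixed first, by differentiability and closeness of the data; the step `τ` is
  -- then chosen small compared with `η`.
  set η := min (ρ / 2) (min (T - t) r) with hη
  have hη0 : 0 < η := lt_min (by positivity) (lt_min (by linarith [ht.2]) hr0)
  have hηρ : η ≤ ρ / 2 := min_le_left _ _
  have hηT : η ≤ T - t := (min_le_right _ _).trans (min_le_left _ _)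
  have hηr : η ≤ r := (min_le_right _ _).trans (min_le_right _ _)
  set s := t + η with hs
  have hs' : s ∈ Icc 0 T := ⟨by linarith [ht.1], by linarith⟩
  have hxs : ‖x s - x t - η • p‖ ≤ ε₁ * η := by
    have := hρ (y := s) (by rw [Real.dist_eq, hs, add_sub_cancel_left, abs_of_pos hη0]; linarith)
    rwa [hs, add_sub_cancel_left, Real.norm_of_nonneg hη0.le] at this
  set W := ‖f t (x t)‖ + ‖B‖ * V with hW
  have hW0 : 0 ≤ W := by positivity
  have e1 := eventually_hyperfilter (eventually_step_le T
    (ε := min (η / 4) (min r (ε₁ * η / (2 * (W + 1)))))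
    (lt_min (by positivity) (lt_min hr0 (by positivity))))
  have e2 := eventually_hyperfilter (E.and (Filter.eventually_gt_atTop 0))
  have hrad : 0 < min (δ / 4) (ε₁ * η / 2) := lt_min (by positivity) (by positivity)
  have e3 := (hx t ht').eventually (closedBall_mem_nhds _ hrad)
  have e4 := (hx s hs').eventually (closedBall_mem_nhds _ hrad)
  obtain ⟨N, ⟨h1, h2, hN⟩, h3, h4⟩ := ((e1.and e2).and (e3.and e4)).exists
  rw [dist_eq_norm] at h3 h4
  set τ := T / (N : ℝ) with hτ
  have hN' : (0 : ℝ) < N := by exact_mod_cast hN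
  have hτ0 : 0 < τ := by positivity
  have hτη : τ ≤ η / 4 := h1.trans (min_le_left _ _)
  have hτr : τ ≤ r := h1.trans ((min_le_right _ _).trans (min_le_left _ _))
  have hτW : 2 * τ * W ≤ ε₁ * η := by
    have h5 : τ ≤ ε₁ * η / (2 * (W + 1)) := h1.trans ((min_le_right _ _).trans (min_le_right _ _))
    rw [le_div_iff₀ (by positivity)] at h5
    nlinarith
  set i := gridIndex T N t
  set j := gridIndex T N s
  have hi1 : (i : ℝ) * τ ≤ t := gridIndex_mul_le hT hN ht.1.le
  have hi2 : t < i * τ + τ := lt_gridIndex_mul_add hT hN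
  have hj1 : (j : ℝ) * τ ≤ s := gridIndex_mul_le hT hN hs'.1
  have hj2 : s < j * τ + τ := lt_gridIndex_mul_add hT hN
  have hjN : j ≤ N := gridIndex_le hT hN hs'
  have hij : i < j := by
    have h5 : (i : ℝ) * τ < j * τ := by linarith
    exact_mod_cast lt_of_mul_lt_mul_right h5 hτ0.le
  have hrδ : r * (4 * (1 + V)) = δ := by rw [hr]; field_simp
  have hrV : 4 * r + 4 * (V * r) = δ := by linarith
  have hVr : 0 ≤ V * r := by positivity
  have hnear : ∀ l, i ≤ l → l ≤ j → |l * τ - t| ≤ δ ∧ ‖X N l - x t‖ ≤ δ := by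
    intro l hil hlj
    have h5 : (i : ℝ) * τ ≤ l * τ := by gcongr
    have h6 : (l : ℝ) * τ ≤ j * τ := by gcongr
    refine ⟨by rw [abs_le]; constructor <;> linarith, ?_⟩
    have h7 := h2.norm_sub_le hil (hlj.trans hjN)
    have h8 : V * ((l - i : ℝ) * τ) ≤ V * (3 * r) :=
      mul_le_mul_of_nonneg_left (by linarith) hV
    have h9 := norm_sub_le_norm_sub_add_norm_sub (X N l) (X N i) (x t)
    have h10 := h3.trans (min_le_left _ _)
    linarith
  obtain ⟨u, hu, hinc⟩ := h2.exists_average S hD hτ0.le hV ht.1.le (ε := ε₁) hij hjN hnear (by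
    intro l hil hlj
    obtain ⟨k1, k2⟩ := hnear l hil hlj.le
    refine hδf _ ⟨by positivity, ?_⟩ _ (k1.trans (min_le_left _ _)) (k2.trans (min_le_left _ _))
    have h6 : (l : ℝ) * τ ≤ j * τ := by gcongr
    linarith [hs'.2])
  refine ⟨u, approxMultipliers_mono hκδ hu, ?_⟩
  set g := f t (x t) - B u with hg
  have hgW : ‖g‖ ≤ W := by
    rw [hW]
    refine (norm_sub_le _ _).trans (add_le_add le_rfl ((B.le_opNorm u).trans ?_))
    gcongr
    exact hu.2.1
  set σ := (j - i : ℝ) * τ with hσ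
  have hσ1 : |σ - η| ≤ 2 * τ := by
    rw [abs_le]; constructor <;> linarith
  have hσ2 : σ ≤ 2 * η := by linarith
  -- The errors are, in order: differentiability, convergence at both ends of the window, averaging
  -- of the multipliers, and the mismatch between `η` and the grid length `σ`.
  have key : η • (f t (x t) - p - B u) = (x s - x t - η • p) - (x s - X N j) + (x t - X N i) -
      (X N j - X N i - σ • g) - (σ - η) • g := by
    rw [hg]; module
  have h5 : ‖x s - X N j‖ ≤ ε₁ * η / 2 := by
    rw [norm_sub_rev]; exact h4.trans (min_le_right _ _)
  have h6 : ‖x t - X N i‖ ≤ ε₁ * η / 2 := by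
    rw [norm_sub_rev]; exact h3.trans (min_le_right _ _)
  have h7 : ‖X N j - X N i - σ • g‖ ≤ 2 * η * ε₁ := hinc.trans (by gcongr)
  have h8 : ‖(σ - η) • g‖ ≤ ε₁ * η := by
    rw [norm_smul, Real.norm_eq_abs]
    calc |σ - η| * ‖g‖ ≤ 2 * τ * W := by gcongr
      _ ≤ _ := hτW
  have h9 : η * ‖f t (x t) - p - B u‖ ≤ η * ε := by
    calc η * ‖f t (x t) - p - B u‖ = ‖η • (f t (x t) - p - B u)‖ := by
          rw [norm_smul, Real.norm_of_nonneg hη0.le]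
      _ ≤ ‖x s - x t - η • p‖ + ‖x s - X N j‖ + ‖x t - X N i‖ + ‖X N j - X N i - σ • g‖ +
          ‖(σ - η) • g‖ := by
          rw [key]
          refine (norm_sub_le _ _).trans (add_le_add ?_ le_rfl)
          refine (norm_sub_le _ _).trans (add_le_add ?_ le_rfl)
          refine (norm_add_le _ _).trans (add_le_add ?_ le_rfl)
          exact norm_sub_le _ _
      _ ≤ ε₁ * η + ε₁ * η / 2 + ε₁ * η / 2 + 2 * η * ε₁ + ε₁ * η := by gcongr
      _ = η * ε := by rw [hε₁]; ring
  exact le_of_mul_le_mul_left h9 hη0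

end Limit

/-! ### Existence, and reduction to the section by the range of `C` -/

/-- Existence of solutions. -/
lemma IsSweepingData.exists_solution {n m : ℕ} {f : ℝ → Euc n → Euc n} {B : Euc m →L[ℝ] Euc n}
    {C : Euc n →L[ℝ] Euc m} {D : Euc m →L[ℝ] Euc m} {P : Euc n →L[ℝ] Euc n} {α c : ℝ}
    {K : ℝ → Euc n → Set (Euc m)} {K₁ : ℝ → Set (Euc m)} {h : ℝ → Euc n → Euc m} {T L : ℝ}
    (S : IsSweepingData C D K₁ h T L) (hT : 0 < T) (H : IsPassiveTriple B C D P α c)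
    (hlift : ∀ t ∈ Icc 0 T, ∀ x, ∀ u ∈ C.range,
      u ∈ normalConeAt ((K₁ t ∩ range C) + {h t x}) (C x - D u) →
      ∃ u' ∈ normalConeAt (K t x) (C x - D u), u' - u ∈ (C.range)ᗮ)
    (hf : ∀ t ∈ Icc 0 T, ∀ y, ∀ ε > 0, ∃ δ > 0, ∀ s ∈ Icc 0 T, ∀ z, |s - t| ≤ δ → ‖z - y‖ ≤ δ →
      ‖f s z - f t y‖ ≤ ε)
    {Af : ℝ} (hAf : 0 ≤ Af) (hfg : ∀ t ∈ Icc 0 T, ∀ x, ‖f t x‖ ≤ Af * (1 + ‖x‖)) {x₀ : Euc n}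
    {u₀ : Euc m} (hu₀ : u₀ ∈ symRange D)
    (hn₀ : u₀ ∈ normalConeAt ((K₁ 0 ∩ range C) + {h 0 x₀}) (C x₀ - D u₀)) :
    ∃ x, IsLureSolution f B C D K T x₀ x := by
  obtain ⟨V, hV, τ₀, hτ₀, hdis⟩ := S.exists_discrete hT H hAf hfg hu₀ hn₀
  have hdis' : ∀ N : ℕ, ∃ (X : ℕ → Euc n) (v : ℕ → Euc m), X 0 = x₀ ∧ (0 < N → T / N ≤ τ₀ →
      IsEulerScheme f B C D K₁ h (T / N) V N X v) := by
    intro N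
    by_cases hN : 0 < N ∧ T / N ≤ τ₀
    · obtain ⟨X, v, h1, h2⟩ := hdis N hN.1 hN.2
      exact ⟨X, v, h1, fun _ _ => h2⟩
    · exact ⟨fun _ => x₀, 0, rfl, fun h1 h2 => (hN ⟨h1, h2⟩).elim⟩
  choose X v hX0 hXv using hdis'
  have E : ∀ᶠ N : ℕ in Filter.atTop, IsEulerScheme f B C D K₁ h (T / N) V N (X N) (v N) := by
    filter_upwards [eventually_step_le T hτ₀, Filter.eventually_gt_atTop 0] with N h1 h2
    exact hXv N h2 h1
  obtain ⟨x, hlip, hx⟩ := exists_limit_scheme hT hV E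
  have hl : ∀ t ∈ Icc 0 T, ∃ l, -l ∈ normalConeAt (K t (x t)) (C (x t) + D l) ∧
      (t ∈ Ioo 0 T → ∀ p, HasDerivAt x p t → p = f t (x t) + B l) := by
    intro t ht
    obtain ⟨u, huR, hun, hup⟩ : ∃ u ∈ C.range,
        u ∈ normalConeAt ((K₁ t ∩ range C) + {h t (x t)}) (C (x t) - D u) ∧
        (t ∈ Ioo 0 T → ∀ p, HasDerivAt x p t → f t (x t) - p = B u) := by
      -- The multiplier must satisfy the differential equation only at interior points of
      -- differentiability; elsewhere the static inclusion suffices.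
      by_cases hcase : t ∈ Ioo 0 T ∧ ∃ p, HasDerivAt x p t
      · obtain ⟨ht', p, hp⟩ := hcase
        obtain ⟨u, h1, h2, h3⟩ :=
          exists_multiplier_limit_of_hasDerivAt hT hV S H.monotone hf E hx ht' hp
        exact ⟨u, h1, h2, fun _ p' hp' => by rw [hp'.unique hp, h3]⟩
      · obtain ⟨u, h1, h2⟩ := exists_multiplier_limit hT hV S E hx ht
        exact ⟨u, h1, h2, fun ht' p hp => (hcase ⟨ht', p, hp⟩).elim⟩
    obtain ⟨u', hu', horth⟩ := hlift t ht (x t) u huR hun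
    have hDu : D u' = D u := by
      have := H.D_apply_orthogonal horth
      rwa [map_sub, sub_eq_zero] at this
    have hBu : B u' = B u := by
      have := H.B_apply_orthogonal horth
      rwa [map_sub, sub_eq_zero] at this
    refine ⟨-u', ?_, fun ht' p hp => ?_⟩
    · rw [neg_neg, map_neg, ← sub_eq_add_neg, hDu]
      exact hu'
    · rw [map_neg, hBu, ← hup ht' p hp]
      abel
  choose! l hl1 hl2 using hl
  refine ⟨x, hlip.lipschitzOnWith.absolutelyContinuousOnInterval, ?_,
    l, fun t => C (x t) + D (l t), ?_, fun t _ => rfl, hl1⟩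
  · have h1 := hx 0 ⟨le_rfl, hT.le⟩
    have h2 : (fun N => X N (gridIndex T N 0)) = fun _ => x₀ := by
      funext N
      simp [gridIndex, hX0]
    rw [h2] at h1
    exact tendsto_nhds_unique h1 tendsto_const_nhds
  · rw [← Measure.restrict_congr_set (Ioo_ae_eq_Icc (μ := volume) (a := (0 : ℝ)) (b := T))]
    filter_upwards [ae_restrict_of_ae hlip.ae_differentiableAt_real,
      ae_restrict_mem measurableSet_Ioo] with t ht ht'
    have := ht.hasDerivAt
    rwa [hl2 t (Ioo_subset_Icc_self ht') ht' _ this] at this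

lemma add_singleton_inter_range {n m : ℕ} {C : Euc n →L[ℝ] Euc m} {Q : Set (Euc m)} {h : Euc m}
    (hh : h ∈ C.range) : (Q + {h}) ∩ range C = (Q ∩ range C) + {h} := by
  ext y
  constructor
  · rintro ⟨hy, hyC⟩
    obtain ⟨a, ha, rfl⟩ := mem_add_singleton_iff.1 hy
    refine mem_add_singleton_iff.2 ⟨a, ⟨ha, ?_⟩, rfl⟩
    have : a = (a + h) - h := by abel
    rw [this]
    exact C.range.sub_mem hyC hh
  · intro hy
    obtain ⟨a, ⟨ha, haC⟩, rfl⟩ := mem_add_singleton_iff.1 hy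
    exact ⟨add_mem_add ha rfl, C.range.add_mem haC hh⟩

lemma mem_feedback_iff {m : ℕ} {S : Set (Euc m)} {D : Euc m →L[ℝ] Euc m} {w v : Euc m} :
    v ∈ feedback S D w ↔ v ∈ normalConeAt S (w - D v) := by
  constructor
  · rintro ⟨y, hy, rfl⟩
    rwa [add_sub_cancel_right]
  · intro hv
    exact ⟨_, hv, by abel⟩

/-- Under the relative interior condition a normal to the section of a set by the range of `C`
is, up to the orthogonal complement of that range, a normal to the set itself. -/
lemma exists_normal_of_normal_section {n m : ℕ} {C : Euc n →L[ℝ] Euc m} {D : Euc m →L[ℝ] Euc m}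
    (hDC : range D ⊆ range C) {K : Set (Euc m)} (hK : Convex ℝ K)
    (hri : (range C ∩ intrinsicInterior ℝ (invNormalAddRange K D)).Nonempty) {y u : Euc m}
    (hy : y ∈ C.range) (hu : u ∈ normalConeAt (K ∩ range C) y) :
    ∃ v ∈ normalConeAt K y, v - u ∈ (C.range)ᗮ := by
  -- The range of `N_K⁻¹ + D` contains `K` (take the zero normal) and equals it modulo `rge D ⊆ rge
  -- C`.
  refine exists_normal_of_normal_inter hK C.range (G := invNormalAddRange K D) ?_ ?_ hri hy hu
  · intro z hz
    exact ⟨0, z, ⟨hz, fun _ _ => by simp⟩, by simp⟩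
  · rintro g ⟨v, z, hz, rfl⟩
    exact ⟨z, hz.1, by rw [add_sub_cancel_left]; exact hDC ⟨v, rfl⟩⟩

/-- Raising `L` to `L + 1` makes the inequality strict for `t ≠ s`, so that a nearby point exists
without attainment of the distance. -/
lemma exists_dist_le_of_hausdorffEDist_le {E : Type*} [SeminormedAddCommGroup E]
    {Q : ℝ → Set E} {L : ℝ} (hL : 0 ≤ L)
    (hQ : ∀ t s, 0 ≤ t → 0 ≤ s → hausdorffEDist (Q t) (Q s) ≤ ENNReal.ofReal (L * |t - s|))
    {t s : ℝ} (ht : 0 ≤ t) (hs : 0 ≤ s) {a : E} (ha : a ∈ Q t) :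
    ∃ b ∈ Q s, ‖a - b‖ ≤ (L + 1) * |t - s| := by
  rcases eq_or_ne t s with rfl | hts
  · exact ⟨a, ha, by simp⟩
  · have hpos : 0 < |t - s| := abs_pos.2 (sub_ne_zero.2 hts)
    have hlt : hausdorffEDist (Q t) (Q s) < ENNReal.ofReal ((L + 1) * |t - s|) := by
      refine (hQ t s ht hs).trans_lt ?_
      rw [ENNReal.ofReal_lt_ofReal_iff (by positivity)]
      linarith
    obtain ⟨b, hb, hab⟩ := exists_edist_lt_of_hausdorffEDist_lt ha hlt
    refine ⟨b, hb, ?_⟩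
    rw [edist_dist, ENNReal.ofReal_lt_ofReal_iff (by positivity), dist_eq_norm] at hab
    exact hab.le

section VectorField

variable {n : ℕ} {f : ℝ → Euc n → Euc n} {vf : ℝ → ℝ} {Lf T : ℝ}

lemma exists_delta_of_modulus (hvf : ContinuousOn vf (Ici 0)) (hLf : 0 < Lf)
    (hf : ∀ t s, 0 ≤ t → 0 ≤ s → ∀ x y, ‖f t x - f s y‖ ≤ |vf t - vf s| + Lf * ‖x - y‖)
    {t : ℝ} (ht : 0 ≤ t) (y : Euc n) {ε : ℝ} (hε : 0 < ε) :
    ∃ δ > 0, ∀ s, 0 ≤ s → ∀ z, |s - t| ≤ δ → ‖z - y‖ ≤ δ → ‖f s z - f t y‖ ≤ ε := by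
  obtain ⟨δ, hδ, h⟩ := Metric.continuousOn_iff.1 hvf t ht (ε / 2) (by positivity)
  refine ⟨min (δ / 2) (ε / (2 * Lf)), lt_min (by positivity) (by positivity), ?_⟩
  intro s hs z hst hzy
  have h1 := h s hs (by
    rw [Real.dist_eq]
    have := hst.trans (min_le_left _ _)
    linarith)
  rw [Real.dist_eq] at h1
  have h2 : Lf * ‖z - y‖ ≤ Lf * (ε / (2 * Lf)) := by
    gcongr
    exact hzy.trans (min_le_right _ _)
  have h3 : Lf * (ε / (2 * Lf)) = ε / 2 := by field_simp
  have := hf s t hs ht z y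
  linarith

lemma exists_growth_of_modulus (hvf : ContinuousOn vf (Ici 0)) (hLf : 0 < Lf)
    (hf : ∀ t s, 0 ≤ t → 0 ≤ s → ∀ x y, ‖f t x - f s y‖ ≤ |vf t - vf s| + Lf * ‖x - y‖) :
    ∃ A : ℝ, 0 ≤ A ∧ ∀ t ∈ Icc 0 T, ∀ x, ‖f t x‖ ≤ A * (1 + ‖x‖) := by
  obtain ⟨M, hM⟩ := isCompact_Icc.exists_bound_of_continuousOn
    (hvf.mono (Icc_subset_Ici_self : Icc 0 T ⊆ Ici 0))
  refine ⟨‖f 0 0‖ + |M| + |vf 0| + Lf, by positivity, fun t ht x => ?_⟩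
  have h1 := hf t 0 ht.1 le_rfl x 0
  have h2 := norm_le_norm_add_norm_sub' (f t x) (f 0 0)
  have h3 : |vf t - vf 0| ≤ |M| + |vf 0| :=
    (abs_sub _ _).trans (add_le_add ((hM t ht).trans (le_abs_self M)) le_rfl)
  rw [sub_zero] at h1
  have h4 : 0 ≤ (‖f 0 0‖ + |M| + |vf 0|) * ‖x‖ := by positivity
  linarith

end VectorField

/-! ### The main theorem -/

theorem theorem2 {n m : ℕ} (T : ℝ) (hT : 0 < T)
    (f : ℝ → Euc n → Euc n) (B : Euc m →L[ℝ] Euc n) (C : Euc n →L[ℝ] Euc m)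
    (D : Euc m →L[ℝ] Euc m) (K : ℝ → Euc n → Set (Euc m))
    -- the moving set is `K(t,x) = K₁(t) + h(t,x)`
    (K₁ : ℝ → Set (Euc m)) (h : ℝ → Euc n → Euc m)
    (hK : ∀ t, 0 ≤ t → ∀ x, K t x = K₁ t + {h t x})
    (hK₁ : ∀ t, 0 ≤ t → (K₁ t).Nonempty ∧ IsClosed (K₁ t) ∧ Convex ℝ (K₁ t))
    (hh : ∀ t, 0 ≤ t → ∀ x, h t x ∈ symRange D)
    (Lh₁ Lh₂ Lh : ℝ) (hLh₁ : 0 ≤ Lh₁) (hLh₂ : 0 ≤ Lh₂) (hLh : 0 ≤ Lh)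
    (hK₁Lip : ∀ t s, 0 ≤ t → 0 ≤ s →
      hausdorffEDist (K₁ t ∩ range C) (K₁ s ∩ range C) ≤ ENNReal.ofReal (Lh₁ * |t - s|))
    (hhLip : ∀ t s, 0 ≤ t → 0 ≤ s → ∀ x y,
      ‖h t x - h s y‖ ≤ Lh₂ * |t - s| + Lh * ‖x - y‖)
    -- positive semidefiniteness of `D`, range and kernel conditions
    (hD : ∀ v, 0 ≤ ⟪D v, v⟫_ℝ)
    (hDC : range D ⊆ range C)
    (hP : ∃ P : Euc n →L[ℝ] Euc n, (∀ x y, ⟪P x, y⟫_ℝ = ⟪x, P y⟫_ℝ) ∧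
      (∃ α : ℝ, 0 < α ∧ ∀ x, α * ‖x‖ ^ 2 ≤ ⟪P x, x⟫_ℝ) ∧
      symKer D ≤ (P.comp B - ContinuousLinearMap.adjoint C).ker)
    -- the feedback map meets `rge (D + Dᵀ)` wherever it is nonempty
    (hmeet : ∀ t, 0 ≤ t → ∀ x y, (feedback (K t y) D (C x)).Nonempty →
      ((symRange D : Set (Euc m)) ∩ feedback (K t y) D (C x)).Nonempty)
    -- relative interior condition
    (hrint : ∀ t ∈ Icc 0 T, ∀ x,
      (range C ∩ intrinsicInterior ℝ (invNormalAddRange (K t x) D)).Nonempty)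
    -- regularity of `f`
    (vf : ℝ → ℝ) (hvf : ContinuousOn vf (Ici 0)) (Lf : ℝ) (hLf : 0 < Lf)
    (hf : ∀ t s, 0 ≤ t → 0 ≤ s → ∀ x y,
      ‖f t x - f s y‖ ≤ |vf t - vf s| + Lf * ‖x - y‖) :
    -- existence and uniqueness on `[0,T]`
    (∀ x₀ ∈ admissibleSet C D K,
      (∃ x, IsLureSolution f B C D K T x₀ x) ∧
      ∀ x x', IsLureSolution f B C D K T x₀ x → IsLureSolution f B C D K T x₀ x' →
        EqOn x x' (Icc 0 T)) ∧
    -- Lipschitz dependence on the initial point, uniformly on `[0,T]`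
    (∃ L : ℝ, 0 ≤ L ∧ ∀ x₁₀ ∈ admissibleSet C D K, ∀ x₂₀ ∈ admissibleSet C D K, ∀ x₁ x₂,
      IsLureSolution f B C D K T x₁₀ x₁ → IsLureSolution f B C D K T x₂₀ x₂ →
      ∀ t ∈ Icc 0 T, ‖x₁ t - x₂ t‖ ≤ L * ‖x₁₀ - x₂₀‖) ∧
    -- the explicit constant when the kernel condition holds with `P = I`
    (symKer D ≤ (B - ContinuousLinearMap.adjoint C).ker →
      ∀ c₁ : ℝ, 0 < c₁ → (∀ v ∈ symRange D, c₁ * ‖v‖ ^ 2 ≤ ⟪D v, v⟫_ℝ) →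
      ∀ x₁₀ ∈ admissibleSet C D K, ∀ x₂₀ ∈ admissibleSet C D K, ∀ x₁ x₂,
      IsLureSolution f B C D K T x₁₀ x₁ → IsLureSolution f B C D K T x₂₀ x₂ →
      ∀ t ∈ Icc 0 T, ‖x₁ t - x₂ t‖ ≤
        Real.exp ((Lf + (Lh + ‖B - ContinuousLinearMap.adjoint C‖) ^ 2 / (4 * c₁)) * T) *
          ‖x₁₀ - x₂₀‖) := by
  obtain ⟨P, hPs, ⟨α, hα, hPα⟩, hker⟩ := hP
  obtain ⟨c, hc0, hc⟩ := exists_coercive_symRange hD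
  have H : IsPassiveTriple B C D P α c := ⟨hD, hDC, hα, hPα, hker, hc0, hc⟩
  have hSR := symRange_le_range hD hDC
  have hhLip' : ∀ t, 0 ≤ t → ∀ x y, ‖h t x - h t y‖ ≤ Lh * ‖x - y‖ := fun t ht x y => by
    simpa using hhLip t t ht ht x y
  have hf' : ∀ t, 0 ≤ t → ∀ x y, ‖f t x - f t y‖ ≤ Lf * ‖x - y‖ := fun t ht x y => by
    simpa using hf t t ht ht x y
  have hcomp : ∀ t ∈ Icc 0 T, ∀ x₁₀ x₂₀ x₁ x₂, IsLureSolution f B C D K T x₁₀ x₁ →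
      IsLureSolution f B C D K T x₂₀ x₂ → ∀ {P : Euc n →L[ℝ] Euc n} {α c : ℝ},
      (∀ x y, ⟪P x, y⟫_ℝ = ⟪x, P y⟫_ℝ) → IsPassiveTriple B C D P α c →
      ⟪P (x₁ t - x₂ t), x₁ t - x₂ t⟫_ℝ ≤ Real.exp (2 * ((‖P‖ * Lf +
        (Lh + ‖P.comp B - ContinuousLinearMap.adjoint C‖) ^ 2 / (4 * c)) / α) * t) *
        ⟪P (x₁₀ - x₂₀), x₁₀ - x₂₀⟫_ℝ :=
    fun t ht x₁₀ x₂₀ x₁ x₂ h₁ h₂ P α c hPs H => h₁.quadratic_le hK hh hLf.le H.c_pos hhLip' hf'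
      H.coercive_sym hPs H.alpha_pos H.coercive H.ker_le h₂ ht
  have hlip : ∃ L : ℝ, 0 ≤ L ∧ ∀ x₁₀ x₂₀ x₁ x₂,
      IsLureSolution f B C D K T x₁₀ x₁ → IsLureSolution f B C D K T x₂₀ x₂ →
      ∀ t ∈ Icc 0 T, ‖x₁ t - x₂ t‖ ≤ L * ‖x₁₀ - x₂₀‖ := by
    set γ := 2 * ((‖P‖ * Lf +
      (Lh + ‖P.comp B - ContinuousLinearMap.adjoint C‖) ^ 2 / (4 * c)) / α) with hγ
    have hγ0 : 0 ≤ γ := by positivity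
    -- Passing between the `P`-norm and the Euclidean norm costs `‖P‖` at time `0` and `1 / α` at
    -- time `t`.
    refine ⟨Real.sqrt (Real.exp (γ * T) * ‖P‖ / α), Real.sqrt_nonneg _, ?_⟩
    intro x₁₀ x₂₀ x₁ x₂ h₁ h₂ t ht
    have h3 := hcomp t ht _ _ _ _ h₁ h₂ hPs H
    rw [← hγ] at h3
    have h4 := hPα (x₁ t - x₂ t)
    have h5 : ⟪P (x₁₀ - x₂₀), x₁₀ - x₂₀⟫_ℝ ≤ ‖P‖ * ‖x₁₀ - x₂₀‖ ^ 2 := by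
      calc _ ≤ ‖P (x₁₀ - x₂₀)‖ * ‖x₁₀ - x₂₀‖ := real_inner_le_norm _ _
        _ ≤ ‖P‖ * ‖x₁₀ - x₂₀‖ * ‖x₁₀ - x₂₀‖ := by gcongr; exact P.le_opNorm _
        _ = _ := by ring
    have h6 : Real.exp (γ * t) * ⟪P (x₁₀ - x₂₀), x₁₀ - x₂₀⟫_ℝ ≤
        Real.exp (γ * T) * (‖P‖ * ‖x₁₀ - x₂₀‖ ^ 2) := by
      have : Real.exp (γ * t) ≤ Real.exp (γ * T) := by gcongr; exact ht.2
      calc _ ≤ Real.exp (γ * t) * (‖P‖ * ‖x₁₀ - x₂₀‖ ^ 2) := by gcongr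
        _ ≤ _ := by gcongr
    refine abs_le_of_sq_le_sq' ?_ (by positivity) |>.2
    rw [mul_pow, Real.sq_sqrt (by positivity), div_mul_eq_mul_div, le_div_iff₀ hα]
    linarith
  refine ⟨fun x₀ hx₀ => ⟨?_, ?_⟩, ?_, ?_⟩
  · have hsection : ∀ t, 0 ≤ t → ∀ x, K t x ∩ range C = (K₁ t ∩ range C) + {h t x} :=
      fun t ht x => by rw [hK t ht, add_singleton_inter_range (hSR (hh t ht x))]
    have hrestrict : ∀ t, 0 ≤ t → ∀ x y, ∀ u, u ∈ normalConeAt (K t y) (C x - D u) →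
        u ∈ normalConeAt ((K₁ t ∩ range C) + {h t y}) (C x - D u) := by
      intro t ht x y u hu
      rw [← hsection t ht]
      exact ⟨⟨hu.1, C.range.sub_mem ⟨x, rfl⟩ (hDC ⟨u, rfl⟩)⟩, fun z hz => hu.2 z hz.1⟩
    have hlift : ∀ t ∈ Icc 0 T, ∀ x y, ∀ u,
        u ∈ normalConeAt ((K₁ t ∩ range C) + {h t y}) (C x - D u) →
        ∃ u' ∈ normalConeAt (K t y) (C x - D u), u' - u ∈ (C.range)ᗮ := by
      intro t ht x y u hu
      rw [← hsection t ht.1] at hu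
      refine exists_normal_of_normal_section hDC ?_ (hrint t ht y)
        (C.range.sub_mem ⟨x, rfl⟩ (hDC ⟨u, rfl⟩)) hu
      rw [hK t ht.1]
      exact (hK₁ t ht.1).2.2.add (convex_singleton _)
    have hmeet' : ∀ t, 0 ≤ t → ∀ x y, (feedback (K t y) D (C x)).Nonempty →
        ∃ u ∈ symRange D, u ∈ normalConeAt ((K₁ t ∩ range C) + {h t y}) (C x - D u) := by
      intro t ht x y hne
      obtain ⟨u, huS, hu⟩ := hmeet t ht x y hne
      exact ⟨u, huS, hrestrict t ht x y u (mem_feedback_iff.1 hu)⟩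
    obtain ⟨u₀, hu₀, hn₀⟩ := hmeet' 0 le_rfl x₀ x₀ hx₀
    have hnear : ∀ t s, 0 ≤ t → 0 ≤ s → ∀ a ∈ K₁ t ∩ range C, ∃ b ∈ K₁ s ∩ range C,
        ‖a - b‖ ≤ (Lh₁ + 1) * |t - s| := fun t s ht hs a ha =>
      exists_dist_le_of_hausdorffEDist_le hLh₁ hK₁Lip ht hs ha
    have S : IsSweepingData C D K₁ h T (Lh₁ + 1 + Lh₂ + Lh) := by
      refine ⟨by positivity, fun t ht => ?_, fun t ht => ?_, fun t ht => ?_, ?_, hh, ?_, ?_⟩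
      · exact (hK₁ t ht).2.1.inter C.range.closed_of_finiteDimensional
      · exact (hK₁ t ht).2.2.inter C.range.convex
      · obtain ⟨a, ha, -⟩ := mem_add_singleton_iff.1 hn₀.1
        obtain ⟨b, hb, -⟩ := hnear 0 t le_rfl ht a ha
        exact ⟨b, hb⟩
      · intro t s ht hs a ha
        obtain ⟨b, hb, hab⟩ := hnear t s ht hs a ha
        exact ⟨b, hb, hab.trans (mul_le_mul_of_nonneg_right (by linarith) (abs_nonneg _))⟩
      · intro t s ht hs x y
        refine (hhLip t s ht hs x y).trans ?_
        rw [mul_add]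
        gcongr <;> linarith
      · intro t ht x y v hv hvn
        refine hmeet' t ht.1 x y ?_
        -- Lifting the normal to `K` shows that the feedback is nonempty, so condition 3 applies.
        obtain ⟨v', hv', horth⟩ := hlift t ht x y v hvn
        refine ⟨v', mem_feedback_iff.2 ?_⟩
        have hDv := H.D_apply_orthogonal horth
        rw [map_sub, sub_eq_zero] at hDv
        rwa [hDv]
    obtain ⟨Af, hAf, hfg⟩ := exists_growth_of_modulus (T := T) hvf hLf hf
    refine S.exists_solution hT H (fun t ht x u _ hu => hlift t ht x x u hu) ?_ hAf hfg hu₀ hn₀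
    intro t ht y ε hε
    obtain ⟨δ, hδ, hδf⟩ := exists_delta_of_modulus hvf hLf hf ht.1 y hε
    exact ⟨δ, hδ, fun s hs => hδf s hs.1⟩
  · intro x x' hx hx' t ht
    obtain ⟨L, -, hL⟩ := hlip
    have := hL _ _ _ _ hx hx' t ht
    rw [sub_self, norm_zero, mul_zero] at this
    exact sub_eq_zero.1 (norm_le_zero_iff.1 this)
  · obtain ⟨L, hL0, hL⟩ := hlip
    exact ⟨L, hL0, fun x₁₀ _ x₂₀ _ => hL x₁₀ x₂₀⟩
  · intro hker₁ c₁ hc₁ hcoer x₁₀ _ x₂₀ _ x₁ x₂ h₁ h₂ t ht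
    have hid : (ContinuousLinearMap.id ℝ (Euc n)).comp B = B := ContinuousLinearMap.id_comp B
    have H₁ : IsPassiveTriple B C D (ContinuousLinearMap.id ℝ (Euc n)) 1 c₁ := by
      refine ⟨hD, hDC, one_pos, fun x => ?_, ?_, hc₁, hcoer⟩
      · rw [ContinuousLinearMap.id_apply, real_inner_self_eq_norm_sq, one_mul]
      · rwa [hid]
    have h3 := hcomp t ht _ _ _ _ h₁ h₂ (fun _ _ => rfl) H₁
    rw [hid, ContinuousLinearMap.id_apply, ContinuousLinearMap.id_apply,
      real_inner_self_eq_norm_sq, real_inner_self_eq_norm_sq, div_one] at h3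
    set e := (Lh + ‖B - ContinuousLinearMap.adjoint C‖) ^ 2 / (4 * c₁)
    have he : 0 ≤ e := by positivity
    have h4 : Real.exp (2 * (‖ContinuousLinearMap.id ℝ (Euc n)‖ * Lf + e) * t) ≤
        Real.exp ((Lf + e) * T) ^ 2 := by
      rw [← Real.exp_nat_mul]
      refine Real.exp_le_exp.2 ?_
      -- Only `≤` is available, since the identity has norm `0` when `n = 0`.
      have h5 : ‖ContinuousLinearMap.id ℝ (Euc n)‖ * Lf ≤ Lf :=
        mul_le_of_le_one_left hLf.le ContinuousLinearMap.norm_id_le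
      have ht0 := ht.1
      calc 2 * (‖ContinuousLinearMap.id ℝ (Euc n)‖ * Lf + e) * t ≤ 2 * (Lf + e) * T := by
            gcongr
            exact ht.2
        _ = _ := by push_cast; ring
    refine abs_le_of_sq_le_sq' ?_ (by positivity) |>.2
    rw [mul_pow]
    exact h3.trans (by gcongr)
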